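/- Let $n\ge 1$ and let $\mathcal T$ be a normal tiling of $\mathbb R^n$, that is, a face-to-face tiling of $\mathbb R^n$ by full-dimensional convex polytopes for which the inradii of the tiles are bounded from below by a positive constant and the circumradii are bounded from above. For $\rho>0$ let $f_i(\rho)$ be the number of $i$-dimensional faces of the tiling ($0\le i\le n$; the tiles are the $n$-dimensional faces) that intersect the open ball of radius $\rho$ around the origin. (1) For every $\rho>0$ all the numbers $f_i(\rho)$ are finite and $$\sum_{i=0}^{n}(-1)^i f_i(\rho)=(-1)^{n}.$$ (2) If for some $0\le i\le n$ the limit $\phi_i:=\lim_{\rho\to\infty} f_i(\rho)/\sum_{j=0}^{n} f_j(\rho)$ exists, then $0\le\phi_i\le\frac12$. (3) Suppose that $\mathcal T$ is invariant under a full-dimensional lattice of translations. Then all limits $\phi_i$ ($0\le i\le n$) exist and are strictly positive, and $$\sum_{i=0}^{n}(-1)^i\phi_i=0 .$$ For nonempty $S\subseteq\{0,\dots,n\}$ let $f_S(\rho)$ be the number of chains of faces of the tiling, consisting of one $i$-face for each $i\in S$, all of which intersect the open ball of radius $\rho$ around the origin. Then the limits $\phi_S:=\lim_{\rho\to\infty}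 f_S(\rho)/\sum_{j=0}^{n} f_j(\rho)$ exist and are strictly positive, with $\phi_{\{i\}}=\phi_i$. For any two families of nonnegative real coefficients $(a_S)$, $(b_S)$ indexed by the nonempty subsets $S\subseteq\{0,\dots,n\}$, neither identically zero, the quotient $\sum_S a_Sf_S(\rho)\big/\sum_S b_Sf_S(\rho)$ converges for $\rho\to\infty$ to $\sum_S a_S\phi_S\big/\sum_S b_S\phi_S$, which is positive and finite. In particular the fatness of the tiling is well defined, positive and finite: $$\lim_{\rho\to\infty}\frac{f_1(\rho)+f_2(\rho)}{f_0(\rho)+f_3(\rho)}=\frac{\phi_1+\phi_2}{\phi_0+\phi_3},$$ where $f_i(\rho)=\phi_i=0$ for $i>n$. -/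

import Mathlib

open Filter Topology

namespace PolytopeTiling

variable {E : Type*} [NormedAddCommGroup E] [NormedSpace ℝ E]

/-- A convex polytope: the convex hull of a finite set of points. -/
def IsConvexPolytope (P : Set E) : Prop :=
  ∃ s : Finset E, P = convexHull ℝ (s : Set E)

/-- A face-to-face tiling by full-dimensional convex polytopes. The faces of a polytope `P` are the
sets `F` with `IsExposed ℝ P F`: the sets of maximizers on `P` of a linear functional
(with functional `0` this gives `P` itself), and the empty set. -/
structure IsFaceToFaceTiling (𝒯 : Set (Set E)) : Prop where
  isConvexPolytope : ∀ T ∈ 𝒯, IsConvexPolytope T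
  interior_nonempty : ∀ T ∈ 𝒯, (interior T).Nonempty
  sUnion_eq : ⋃₀ 𝒯 = Set.univ
  disjoint_interior : 𝒯.Pairwise fun T T' => Disjoint (interior T) (interior T')
  inter_face : ∀ T ∈ 𝒯, ∀ T' ∈ 𝒯, IsExposed ℝ T (T ∩ T') ∧ IsExposed ℝ T' (T ∩ T')

/-- A normal tiling: a face-to-face tiling by convex polytopes whose inradii are bounded below by
some `r > 0` and whose circumradii are bounded above by some `R`. -/
structure IsNormalTiling (𝒯 : Set (Set E)) : Prop extends IsFaceToFaceTiling 𝒯 where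
  inradius_bound : ∃ r > 0, ∀ T ∈ 𝒯, ∃ x, Metric.closedBall x r ⊆ T
  circumradius_bound : ∃ R : ℝ, ∀ T ∈ 𝒯, ∃ x, T ⊆ Metric.closedBall x R

/-- The tiling is invariant under all translations by a full-dimensional lattice. -/
def IsLatticePeriodic (𝒯 : Set (Set E)) : Prop :=
  ∃ (L : Submodule ℤ E) (_ : DiscreteTopology L), IsZLattice ℝ L ∧
    ∀ v ∈ L, ∀ T ∈ 𝒯, (fun x => v + x) '' T ∈ 𝒯

/-- The set of `i`-dimensional faces of the tiling (nonempty faces of its tiles, the tiles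
included) that meet the open ball of radius `ρ` around the origin. -/
def facesMeeting (𝒯 : Set (Set E)) (i : ℕ) (ρ : ℝ) : Set (Set E) :=
  {F | (∃ T ∈ 𝒯, IsExposed ℝ T F) ∧ Module.finrank ℝ (vectorSpan ℝ F) = i ∧
    (F ∩ Metric.ball 0 ρ).Nonempty}

/-- `f_i(ρ)`. -/
noncomputable def faceCount (𝒯 : Set (Set E)) (i : ℕ) (ρ : ℝ) : ℕ :=
  (facesMeeting 𝒯 i ρ).ncard

/-- `f_S(ρ)`: the number of chains of faces, one of dimension `i` for each `i ∈ S`, all of which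
meet the open ball of radius `ρ` around the origin. -/
noncomputable def flagCount (𝒯 : Set (Set E)) (S : Finset ℕ) (ρ : ℝ) : ℕ :=
  {c : S → Set E | (∀ i : S, c i ∈ facesMeeting 𝒯 i ρ) ∧ Monotone c}.ncard

end PolytopeTiling

/-! The Euler characteristic with compact support assigns `(-1) ^ dim C` to a nonempty bounded
relatively open convex set `C` and is additive: a linear relation between indicator functions passes
to Euler characteristics (`sum_mul_eulerChar_eq_zero`). The relative interiors of the faces of a
face-to-face tiling partition space. A face `F` meets an open ball exactly when `relInt F` does, and
the resulting piece has the dimension of `F`. Applying additivity to the ball gives the alternating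
sum exactly, with no boundary error. The counts are finite by a volume argument: tiles meeting a
ball have disjoint interiors, volume bounded below, and lie in a slightly larger ball.

Let `N` be the total number of faces meeting the ball. Euler's relation says that even-dimensional
and odd-dimensional faces differ in number by one, so `2 * f_i ≤ N + 1`. Since `N` tends to
infinity, no limit exceeds `1/2`.

For a periodic tiling, chains of type `S` fall into finitely many lattice orbits, say `m_S`. The
translates in one orbit that meet the ball of radius `ρ` correspond to lattice vectors of norm at
most `ρ`, up to a bounded change of radius, so they number about `κ ρ^n`, with `κ` depending only on
the lattice (`tendsto_orbit_count`). Thus `f_S(ρ) / ρ^n` tends to `m_S κ`, and `m_S` is positive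
because every polytope has a complete flag of faces (`IsConvexPolytope.exists_flag`). All limits of
quotients follow, and dividing Euler's relation by `N` gives the alternating sum of the limits. -/

namespace PolytopeTiling

/-! ### The Euler characteristic as a valuation on relatively open convex sets. -/

variable {E : Type*} [NormedAddCommGroup E] [NormedSpace ℝ E]

/-- A convex set that is open in its affine span, in algebraic terms: every segment in the set that
ends at `x` can be prolonged beyond `x`. -/
def IsRelOpenConvex (C : Set E) : Prop :=
  Convex ℝ C ∧ ∀ x ∈ C, ∀ y ∈ C, ∃ ε : ℝ, 0 < ε ∧ x + ε • (x - y) ∈ C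

/-- The Euler characteristic with compact support of a relatively open bounded convex set. -/
noncomputable def eulerChar (C : Set E) : ℤ :=
  open Classical in if C.Nonempty then (-1) ^ Module.finrank ℝ (vectorSpan ℝ C) else 0

theorem _root_.Convex.add_smul_mem_of_le {C : Set E} (hC : Convex ℝ C) {x v : E} (hx : x ∈ C)
    {ε δ : ℝ} (hv : x + ε • v ∈ C) (hδ : 0 ≤ δ) (hδε : δ ≤ ε) : x + δ • v ∈ C := by
  rcases hδ.eq_or_lt with rfl | hδ'
  · simpa using hx
  have hε : 0 < ε := hδ'.trans_le hδε
  have := hC.add_smul_mem hx hv (t := δ / ε) ⟨by positivity, by rw [div_le_one hε]; exact hδε⟩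
  rwa [smul_smul, div_mul_cancel₀ _ hε.ne'] at this

/-- The directions in which one can move from `x` inside `C` form a subspace: convexity gives sums,
prolongation gives negatives. It contains every `y - x` with `y ∈ C`. -/
theorem IsRelOpenConvex.exists_add_smul_mem {C : Set E} (hC : IsRelOpenConvex C) {x v : E}
    (hx : x ∈ C) (hv : v ∈ vectorSpan ℝ C) : ∃ ε : ℝ, 0 < ε ∧ x + ε • v ∈ C := by
  rw [vectorSpan_eq_span_vsub_set_right ℝ hx] at hv
  induction hv using Submodule.span_induction with
  | mem v hv =>
    obtain ⟨y, hy, rfl⟩ := hv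
    exact ⟨1, one_pos, by simpa using hy⟩
  | zero => exact ⟨1, one_pos, by simpa using hx⟩
  | add v w _ _ hv hw =>
    obtain ⟨ε, hε, hv⟩ := hv
    obtain ⟨δ, hδ, hw⟩ := hw
    -- The weights `δ / (ε + δ)` and `ε / (ε + δ)` give `v` and `w` the same coefficient.
    refine ⟨ε * δ / (ε + δ), by positivity, ?_⟩
    have h := hC.1 hv hw (show 0 ≤ δ / (ε + δ) by positivity)
      (show 0 ≤ ε / (ε + δ) by positivity) (by field_simp; ring)
    convert h using 1
    have h1 : δ / (ε + δ) + ε / (ε + δ) = 1 := by field_simp; ring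
    match_scalars
    · linarith
    · field_simp
    · field_simp
  | smul a v _ hv =>
    obtain ⟨ε, hε, hv⟩ := hv
    rcases lt_trichotomy a 0 with ha | rfl | ha
    · obtain ⟨δ, hδ, h⟩ := hC.2 x hx _ hv
      refine ⟨δ * ε / (-a), div_pos (mul_pos hδ hε) (neg_pos.2 ha), ?_⟩
      convert h using 1
      match_scalars
      · ring
      · field_simp
        rw [div_self ha.ne]
    · exact ⟨1, one_pos, by simpa using hx⟩
    · refine ⟨ε / a, by positivity, ?_⟩
      rwa [smul_smul, div_mul_cancel₀ _ ha.ne']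

theorem IsRelOpenConvex.slice {C : Set E} (hC : IsRelOpenConvex C) (l : E →L[ℝ] ℝ) (t : ℝ) :
    IsRelOpenConvex (C ∩ {x | l x = t}) := by
  refine ⟨hC.1.inter (convex_hyperplane l.isLinear t), fun x hx y hy => ?_⟩
  obtain ⟨ε, hε, h⟩ := hC.2 x hx.1 y hy.1
  refine ⟨ε, hε, h, ?_⟩
  have h1 : l x = t := hx.2
  have h2 : l y = t := hy.2
  simp [h1, h2]

theorem IsRelOpenConvex.inter_open {C U : Set E} (hC : IsRelOpenConvex C) (hU : IsOpen U)
    (hU' : Convex ℝ U) : IsRelOpenConvex (C ∩ U) := by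
  refine ⟨hC.1.inter hU', fun x hx y hy => ?_⟩
  obtain ⟨ε, hε, h⟩ := hC.2 x hx.1 y hy.1
  have h1 : ∀ᶠ δ : ℝ in 𝓝[>] 0, x + δ • (x - y) ∈ U := by
    refine Filter.Eventually.filter_mono nhdsWithin_le_nhds ?_
    have : Tendsto (fun δ : ℝ => x + δ • (x - y)) (𝓝 0) (𝓝 (x + (0 : ℝ) • (x - y))) :=
      Continuous.tendsto (by fun_prop) 0
    rw [zero_smul, add_zero] at this
    exact this.eventually (hU.mem_nhds hx.2)
  obtain ⟨δ, h2, h3⟩ := (h1.and (Ioo_mem_nhdsGT hε)).exists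
  exact ⟨δ, h3.1, hC.1.add_smul_mem_of_le hx.1 h h3.1.le h3.2.le, h2⟩

theorem IsRelOpenConvex.vectorSpan_inter_open {C U : Set E} (hC : IsRelOpenConvex C)
    (hU : IsOpen U) (hne : (C ∩ U).Nonempty) :
    vectorSpan ℝ (C ∩ U) = vectorSpan ℝ C := by
  refine le_antisymm (vectorSpan_mono ℝ Set.inter_subset_left) fun v hv => ?_
  obtain ⟨x, hx⟩ := hne
  obtain ⟨ε, hε, h⟩ := hC.exists_add_smul_mem hx.1 hv
  have h1 : ∀ᶠ δ : ℝ in 𝓝[>] 0, x + δ • v ∈ U := by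
    refine Filter.Eventually.filter_mono nhdsWithin_le_nhds ?_
    have : Tendsto (fun δ : ℝ => x + δ • v) (𝓝 0) (𝓝 (x + (0 : ℝ) • v)) :=
      Continuous.tendsto (by fun_prop) 0
    rw [zero_smul, add_zero] at this
    exact this.eventually (hU.mem_nhds hx.2)
  obtain ⟨δ, h2, h3⟩ := (h1.and (Ioo_mem_nhdsGT hε)).exists
  have h4 := vsub_mem_vectorSpan ℝ
    (show x + δ • v ∈ C ∩ U from ⟨hC.1.add_smul_mem_of_le hx.1 h h3.1.le h3.2.le, h2⟩) hx
  rw [vsub_eq_sub, add_sub_cancel_left] at h4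
  simpa [smul_smul, h3.1.ne'] using Submodule.smul_mem _ δ⁻¹ h4

theorem IsRelOpenConvex.vectorSpan_slice {C : Set E} (hC : IsRelOpenConvex C) (l : E →L[ℝ] ℝ)
    {t : ℝ} (hne : (C ∩ {x | l x = t}).Nonempty) :
    vectorSpan ℝ (C ∩ {x | l x = t}) = vectorSpan ℝ C ⊓ l.ker := by
  obtain ⟨x, hx, hxt⟩ := hne
  refine le_antisymm (le_inf (vectorSpan_mono ℝ Set.inter_subset_left) ?_) fun v hv => ?_
  · rw [vectorSpan_def, Submodule.span_le]
    rintro _ ⟨y, hy, z, hz, rfl⟩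
    have h1 : l y = t := hy.2
    have h2 : l z = t := hz.2
    simp [h1, h2]
  · obtain ⟨ε, hε, h⟩ := hC.exists_add_smul_mem hx hv.1
    have hlv : l v = 0 := by simpa using hv.2
    have hxt' : l x = t := hxt
    have h4 := vsub_mem_vectorSpan ℝ
      (show x + ε • v ∈ C ∩ {x | l x = t} from ⟨h, by simp [hlv, hxt']⟩)
      (show x ∈ C ∩ {x | l x = t} from ⟨hx, hxt⟩)
    rw [vsub_eq_sub, add_sub_cancel_left] at h4
    simpa [smul_smul, hε.ne'] using Submodule.smul_mem _ ε⁻¹ h4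

theorem finrank_inf_ker_add_one [FiniteDimensional ℝ E] (V : Submodule ℝ E) (l : E →L[ℝ] ℝ)
    (h : ∃ v ∈ V, l v ≠ 0) :
    Module.finrank ℝ (V ⊓ l.ker : Submodule ℝ E) + 1 = Module.finrank ℝ V := by
  obtain ⟨v, hv, hlv⟩ := h
  let f : Module.Dual ℝ V := (l : E →ₗ[ℝ] ℝ) ∘ₗ V.subtype
  have hf : f ≠ 0 := fun h0 => hlv (by simpa [f] using LinearMap.congr_fun h0 ⟨v, hv⟩)
  rw [← Module.Dual.finrank_ker_add_one_of_ne_zero hf, ← Submodule.map_comap_subtype,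
    Submodule.finrank_map_subtype_eq]
  rfl

/-- If `l` is constant on `C`, the only nonempty slice is `C` itself. Otherwise `l '' C` is an open
interval, and over it the slices lose one dimension and have characteristic `-eulerChar C`. Only
right-hand differences are taken, so the lower endpoint shows a jump and the upper one does not. -/
theorem eulerChar_slice_jump [FiniteDimensional ℝ E] {C : Set E} (hC : IsRelOpenConvex C)
    (hb : Bornology.IsBounded C) (l : E →L[ℝ] ℝ) : ∃ a : ℝ, ∀ t : ℝ, ∀ᶠ ε in 𝓝[>] (0 : ℝ),
      eulerChar (C ∩ {x | l x = t}) - eulerChar (C ∩ {x | l x = t + ε}) =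
        if t = a then eulerChar C else 0 := by
  rcases C.eq_empty_or_nonempty with rfl | ⟨x₀, hx₀⟩
  · exact ⟨0, fun t => by simp [eulerChar]⟩
  by_cases hl : ∀ y ∈ C, l y = l x₀
  · have key : ∀ t, eulerChar (C ∩ {x | l x = t}) = if t = l x₀ then eulerChar C else 0 := by
      intro t
      split_ifs with ht
      · congr 1
        exact Set.inter_eq_left.2 fun y hy => by simp [hl y hy, ht]
      · rw [eulerChar, if_neg]
        rintro ⟨y, hy, hyt⟩
        exact ht (by rw [← hl y hy]; exact hyt.symm)
    refine ⟨l x₀, fun t => ?_⟩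
    have : ∀ᶠ ε in 𝓝[>] (0 : ℝ), t + ε ≠ l x₀ := by
      rcases lt_or_ge t (l x₀) with h | h
      · filter_upwards [Ioo_mem_nhdsGT (sub_pos.2 h)] with ε hε
        have := hε.2
        intro h'; linarith
      · filter_upwards [self_mem_nhdsWithin] with ε hε
        have : 0 < ε := hε
        intro h'; linarith
    filter_upwards [this] with ε hε
    rw [key, key, if_neg hε, sub_zero]
  push Not at hl
  obtain ⟨y₀, hy₀, hne⟩ := hl
  set I : Set ℝ := l '' C with hI
  have hIb : Bornology.IsBounded I := l.lipschitz.isBounded_image hb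
  have hIne : I.Nonempty := ⟨_, x₀, hx₀, rfl⟩
  have hIc : I.OrdConnected := (hC.1.linear_image (l : E →ₗ[ℝ] ℝ)).ordConnected
  have hmove : ∀ x ∈ C, ∃ y ∈ C, l y ≠ l x := by
    intro x hx
    by_contra! h
    exact hne ((h y₀ hy₀).trans (h x₀ hx₀).symm)
  have hlt : ∀ t ∈ I, ∃ s ∈ I, s < t := by
    rintro _ ⟨x, hx, rfl⟩
    obtain ⟨y, hy, hyx⟩ := hmove x hx
    rcases hyx.lt_or_gt with h | h
    · exact ⟨_, ⟨y, hy, rfl⟩, h⟩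
    · obtain ⟨ε, hε, hz⟩ := hC.2 x hx y hy
      refine ⟨_, ⟨_, hz, rfl⟩, ?_⟩
      simp only [map_add, map_smul, map_sub, smul_eq_mul]
      nlinarith
  have hgt : ∀ t ∈ I, ∃ s ∈ I, t < s := by
    rintro _ ⟨x, hx, rfl⟩
    obtain ⟨y, hy, hyx⟩ := hmove x hx
    rcases hyx.lt_or_gt with h | h
    · obtain ⟨ε, hε, hz⟩ := hC.2 x hx y hy
      refine ⟨_, ⟨_, hz, rfl⟩, ?_⟩
      simp only [map_add, map_smul, map_sub, smul_eq_mul]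
      nlinarith
    · exact ⟨_, ⟨y, hy, rfl⟩, h⟩
  -- Prolonging segments shows that `I` has no least and no greatest element.
  have hmem : ∀ t, t ∈ I ↔ sInf I < t ∧ t < sSup I := by
    refine fun t => ⟨fun ht => ?_, fun ht => ?_⟩
    · obtain ⟨s, hs, hst⟩ := hlt t ht
      obtain ⟨u, hu, htu⟩ := hgt t ht
      exact ⟨(csInf_le hIb.bddBelow hs).trans_lt hst, htu.trans_le (le_csSup hIb.bddAbove hu)⟩
    · obtain ⟨s, hs, hst⟩ := exists_lt_of_csInf_lt hIne ht.1
      obtain ⟨u, hu, htu⟩ := exists_lt_of_lt_csSup hIne ht.2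
      exact hIc.out hs hu ⟨hst.le, htu.le⟩
  have key : ∀ t, eulerChar (C ∩ {x | l x = t}) =
      if sInf I < t ∧ t < sSup I then - eulerChar C else 0 := by
    intro t
    split_ifs with ht
    · obtain ⟨x, hx, hxt⟩ := (hmem t).2 ht
      have hs : (C ∩ {x | l x = t}).Nonempty := ⟨x, hx, hxt⟩
      obtain ⟨y, hy, hyx⟩ := hmove x hx
      have := finrank_inf_ker_add_one (vectorSpan ℝ C) l ⟨y - x, vsub_mem_vectorSpan ℝ hy hx, by
        rw [map_sub]; exact sub_ne_zero.2 hyx⟩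
      rw [eulerChar, eulerChar, if_pos hs, if_pos ⟨x, hx⟩, hC.vectorSpan_slice l hs, ← this,
        pow_succ]
      ring
    · rw [eulerChar, if_neg]
      rintro ⟨y, hy, hyt⟩
      exact ht ((hmem t).1 ⟨y, hy, hyt⟩)
  have hab : sInf I < sSup I := by
    have := (hmem (l x₀)).1 ⟨x₀, hx₀, rfl⟩
    exact this.1.trans this.2
  refine ⟨sInf I, fun t => ?_⟩
  simp only [key]
  rcases lt_trichotomy t (sInf I) with h | h | h
  · filter_upwards [Ioo_mem_nhdsGT (sub_pos.2 h)] with ε hε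
    have := hε.2
    rw [if_neg (fun h' => by linarith [h'.1]), if_neg (fun h' => by linarith [h'.1]), if_neg h.ne,
      sub_zero]
  · filter_upwards [Ioo_mem_nhdsGT (sub_pos.2 hab)] with ε hε
    have := hε.2
    rw [if_neg (fun h' => by linarith [h'.1]), if_pos ⟨by linarith [hε.1], by linarith⟩, if_pos h]
    ring
  · rcases lt_or_ge t (sSup I) with h' | h'
    · filter_upwards [Ioo_mem_nhdsGT (sub_pos.2 h')] with ε hε
      have := hε.2
      rw [if_pos ⟨h, h'⟩, if_pos ⟨by linarith [hε.1], by linarith⟩, if_neg h.ne', sub_self]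
    · filter_upwards [self_mem_nhdsWithin] with ε hε
      have : 0 < ε := hε
      rw [if_neg (fun h' => by linarith [h'.2]), if_neg (fun h' => by linarith [h'.2]),
        if_neg h.ne', sub_zero]

/-- The Euler characteristic is a valuation on bounded relatively open convex sets. -/
theorem sum_mul_eulerChar_eq_zero [FiniteDimensional ℝ E] {ι : Type*} (J : Finset ι) (c : ι → ℤ)
    (C : ι → Set E) (hC : ∀ j ∈ J, IsRelOpenConvex (C j))
    (hb : ∀ j ∈ J, Bornology.IsBounded (C j))
    (h : ∀ x, ∑ j ∈ J, (C j).indicator (fun _ => c j) x = 0) :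
    ∑ j ∈ J, c j * eulerChar (C j) = 0 := by
  -- The induction is on the dimension of a flat `x₀ + W` containing all the sets, so that slices
  -- stay in `E`.
  suffices H : ∀ (d : ℕ) (C : ι → Set E) (W : Submodule ℝ E) (x₀ : E), Module.finrank ℝ W = d →
      (∀ j ∈ J, IsRelOpenConvex (C j)) → (∀ j ∈ J, Bornology.IsBounded (C j)) →
      (∀ x, ∑ j ∈ J, (C j).indicator (fun _ => c j) x = 0) →
      (∀ j ∈ J, ∀ x ∈ C j, x - x₀ ∈ W) → ∑ j ∈ J, c j * eulerChar (C j) = 0 from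
    H _ C ⊤ 0 rfl hC hb h (by simp)
  clear hC hb h C
  intro d
  induction d with
  | zero =>
    intro C W x₀ hW hC hb h hCW
    rw [← h x₀]
    refine Finset.sum_congr rfl fun j hj => ?_
    have hsub : ∀ x ∈ C j, x = x₀ := fun x hx => by
      have := hCW j hj x hx
      rw [Submodule.finrank_eq_zero.1 hW, Submodule.mem_bot, sub_eq_zero] at this
      exact this
    rcases (C j).eq_empty_or_nonempty with h0 | ⟨x, hx⟩
    · simp [h0, eulerChar]
    · have : C j = {x₀} := by
        refine Set.eq_singleton_iff_unique_mem.2 ⟨hsub x hx ▸ hx, hsub⟩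
      rw [this, eulerChar, if_pos (Set.singleton_nonempty x₀), vectorSpan_singleton]
      simp
  | succ d ih =>
    intro C W x₀ hW hC hb h hCW
    obtain ⟨w, hw, hw0⟩ : ∃ w ∈ W, w ≠ 0 := by
      apply Submodule.exists_mem_ne_zero_of_ne_bot
      rintro rfl
      simp at hW
    obtain ⟨l, -, hl⟩ := exists_dual_vector ℝ w (norm_ne_zero_iff.2 hw0)
    have hlw : l w ≠ 0 := by rw [hl]; simpa using hw0
    have hfin := finrank_inf_ker_add_one W l ⟨w, hw, hlw⟩
    have hzero : ∀ t, ∑ j ∈ J, c j * eulerChar (C j ∩ {x | l x = t}) = 0 := by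
      intro t
      -- The new base point is the point of the line `x₀ + ℝ w` where `l` takes the value `t`.
      refine ih (fun j => C j ∩ {x | l x = t}) (W ⊓ l.ker) (x₀ + ((t - l x₀) / l w) • w)
        (by omega) (fun j hj => (hC j hj).slice l t)
        (fun j hj => (hb j hj).subset Set.inter_subset_left) (fun x => ?_) ?_
      · by_cases hx : l x = t
        · rw [← h x]
          refine Finset.sum_congr rfl fun j _ => ?_
          by_cases hxj : x ∈ C j <;> simp [hx, hxj]
        · refine Finset.sum_eq_zero fun j _ => ?_
          simp [Set.indicator, hx]
      · rintro j hj x ⟨hx, hxt⟩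
        have hxt' : l x = t := hxt
        refine ⟨?_, ?_⟩
        · rw [← sub_sub]
          exact W.sub_mem (hCW j hj x hx) (W.smul_mem _ hw)
        · simp [hxt', hlw]
    have hjump : ∀ j ∈ J, ∃ a : ℝ, ∀ t : ℝ, ∀ᶠ ε in 𝓝[>] (0 : ℝ),
        eulerChar (C j ∩ {x | l x = t}) - eulerChar (C j ∩ {x | l x = t + ε}) =
          if t = a then eulerChar (C j) else 0 :=
      fun j hj => eulerChar_slice_jump (hC j hj) (hb j hj) l
    choose! a ha using hjump
    classical
    have hev : ∀ᶠ ε in 𝓝[>] (0 : ℝ), ∀ j ∈ J, ∀ t ∈ J.image a,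
        eulerChar (C j ∩ {x | l x = t}) - eulerChar (C j ∩ {x | l x = t + ε}) =
          if t = a j then eulerChar (C j) else 0 := by
      rw [Filter.eventually_all_finset]
      intro j hj
      rw [Filter.eventually_all_finset]
      intro t _
      exact ha j hj t
    obtain ⟨ε, hε⟩ := hev.exists
    -- Each characteristic is recovered from its jumps over the finitely many jump values, with one
    -- `ε` serving all. After exchanging the sums, every slice sum vanishes by `hzero`.
    calc ∑ j ∈ J, c j * eulerChar (C j)
        = ∑ j ∈ J, ∑ t ∈ J.image a, c j *
            (eulerChar (C j ∩ {x | l x = t}) - eulerChar (C j ∩ {x | l x = t + ε})) := by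
          refine Finset.sum_congr rfl fun j hj => ?_
          rw [← Finset.mul_sum, Finset.sum_congr rfl (hε j hj), Finset.sum_ite_eq',
            if_pos (Finset.mem_image_of_mem a hj)]
      _ = 0 := by
          rw [Finset.sum_comm]
          refine Finset.sum_eq_zero fun t _ => ?_
          simp only [mul_sub, Finset.sum_sub_distrib, hzero, sub_zero]

end PolytopeTiling

/-! ### Faces, relative interiors and flags of convex polytopes. -/

namespace PolytopeTiling

variable {E : Type*} [NormedAddCommGroup E] [NormedSpace ℝ E]

theorem le_of_mem_convexHull {s : Set E} (l : E →L[ℝ] ℝ) {c : ℝ} (h : ∀ v ∈ s, l v ≤ c) {x : E}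
    (hx : x ∈ convexHull ℝ s) : l x ≤ c :=
  convexHull_min h (convex_halfSpace_le l.isLinear c) hx

/-- In a convex combination on which `l` attains its bound `c`, the nonnegative terms `w v * (c - l
v)` sum to zero, so only points with `l v = c` carry weight. -/
theorem convexHull_inter_hyperplane (s : Finset E) (l : E →L[ℝ] ℝ) {c : ℝ}
    (h : ∀ v ∈ s, l v ≤ c) :
    convexHull ℝ (s : Set E) ∩ {x | l x = c} = convexHull ℝ ((s : Set E) ∩ {x | l x = c}) := by
  refine Set.Subset.antisymm ?_ (Set.subset_inter (convexHull_mono Set.inter_subset_left)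
    (convexHull_min Set.inter_subset_right (convex_hyperplane l.isLinear c)))
  rintro x ⟨hx, hxc⟩
  obtain ⟨w, hw0, hw1, rfl⟩ := Finset.mem_convexHull'.1 hx
  have hxc' : ∑ v ∈ s, w v * l v = c := by simpa using hxc
  have hsum : ∑ v ∈ s, w v * (c - l v) = 0 := by
    simp only [mul_sub, Finset.sum_sub_distrib, ← Finset.sum_mul, hw1, hxc', one_mul, sub_self]
  have hz := (Finset.sum_eq_zero_iff_of_nonneg
    (fun v hv => mul_nonneg (hw0 v hv) (sub_nonneg.2 (h v hv)))).1 hsum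
  have hconv := convex_convexHull ℝ ((s : Set E) ∩ {x | l x = c})
  have hmem : ∀ v ∈ s, w v ≠ 0 → v ∈ convexHull ℝ ((s : Set E) ∩ {x | l x = c}) := by
    intro v hv hwv
    refine subset_convexHull ℝ _ ⟨hv, ?_⟩
    have := (mul_eq_zero.1 (hz v hv)).resolve_left hwv
    exact (sub_eq_zero.1 this).symm
  classical
  have hf : ∑ v ∈ s with w v ≠ 0, w v = 1 := by rw [← hw1, Finset.sum_filter_ne_zero]
  have hf' : ∑ v ∈ s, w v • v = ∑ v ∈ s with w v ≠ 0, w v • v := by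
    rw [Finset.sum_filter]
    refine Finset.sum_congr rfl fun v _ => ?_
    split_ifs with hv
    · rfl
    · simp [not_not.1 hv]
  rw [hf']
  refine hconv.sum_mem (fun v hv => hw0 v (Finset.mem_filter.1 hv).1) hf fun v hv => ?_
  exact hmem v (Finset.mem_filter.1 hv).1 (Finset.mem_filter.1 hv).2

theorem isExposed_inter_hyperplane {T : Set E} {l : E →L[ℝ] ℝ} {c : ℝ} (h : ∀ y ∈ T, l y ≤ c) :
    IsExposed ℝ T (T ∩ {x | l x = c}) := by
  rintro ⟨x₀, hx₀, hc⟩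
  have hc' : l x₀ = c := hc
  refine ⟨l, Set.ext fun x => and_congr_right fun hx => ⟨fun hxc y hy => ?_, fun hy => ?_⟩⟩
  · have : l x = c := hxc
    rw [this]; exact h y hy
  · exact le_antisymm (h x hx) (hc' ▸ hy x₀ hx₀)

theorem _root_.IsExposed.exists_eq_inter_hyperplane {T F : Set E} (hF : IsExposed ℝ T F)
    (hne : F.Nonempty) :
    ∃ (l : E →L[ℝ] ℝ) (c : ℝ), (∀ y ∈ T, l y ≤ c) ∧ F = T ∩ {x | l x = c} := by
  obtain ⟨l, hl⟩ := hF hne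
  obtain ⟨x₀, hx₀⟩ := hne
  have hx₀' := hl ▸ hx₀
  refine ⟨l, l x₀, hx₀'.2, ?_⟩
  rw [hl]
  exact Set.ext fun x => and_congr_right fun hx =>
    ⟨fun h => le_antisymm (hx₀'.2 x hx) (h x₀ hx₀'.1), fun h y hy => by
      have : l x = l x₀ := h
      rw [this]; exact hx₀'.2 y hy⟩

theorem eq_convexHull_of_isExposed {s : Finset E} {F : Set E}
    (hF : IsExposed ℝ (convexHull ℝ (s : Set E)) F) : F = convexHull ℝ ((s : Set E) ∩ F) := by
  rcases F.eq_empty_or_nonempty with rfl | hne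
  · simp
  obtain ⟨l, c, hl, rfl⟩ := hF.exists_eq_inter_hyperplane hne
  have h := fun v hv => hl v (subset_convexHull ℝ _ hv)
  rw [convexHull_inter_hyperplane s l h]
  congr 1
  rw [← convexHull_inter_hyperplane s l h, ← Set.inter_assoc,
    Set.inter_eq_left.2 (subset_convexHull ℝ (s : Set E))]

theorem IsConvexPolytope.convex {T : Set E} (hT : IsConvexPolytope T) : Convex ℝ T := by
  obtain ⟨s, rfl⟩ := hT
  exact convex_convexHull ℝ _

theorem IsConvexPolytope.isBounded {T : Set E} (hT : IsConvexPolytope T) :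
    Bornology.IsBounded T := by
  obtain ⟨s, rfl⟩ := hT
  exact isBounded_convexHull.2 s.finite_toSet.isBounded

theorem IsConvexPolytope.of_isExposed {T F : Set E} (hT : IsConvexPolytope T)
    (hF : IsExposed ℝ T F) : IsConvexPolytope F := by
  obtain ⟨s, rfl⟩ := hT
  classical
  refine ⟨s.filter (· ∈ F), ?_⟩
  rw [Finset.coe_filter]
  exact eq_convexHull_of_isExposed hF

theorem IsConvexPolytope.finite_faces {T : Set E} (hT : IsConvexPolytope T) :
    {F | IsExposed ℝ T F}.Finite := by
  obtain ⟨s, rfl⟩ := hT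
  refine (s.finite_toSet.finite_subsets.image (convexHull ℝ)).subset fun F hF => ?_
  exact ⟨_, Set.inter_subset_left, (eq_convexHull_of_isExposed hF).symm⟩

/-- If `l` exposes `F` and `k` exposes `G` in `F`, then `N • l + k` exposes `G` for large `N`.
Having finitely many generators is essential: for general convex sets exposed faces are not
transitive. -/
theorem IsConvexPolytope.isExposed_trans {T F G : Set E} (hT : IsConvexPolytope T)
    (hF : IsExposed ℝ T F) (hG : IsExposed ℝ F G) : IsExposed ℝ T G := by
  rcases G.eq_empty_or_nonempty with rfl | hne
  · exact isExposed_empty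
  obtain ⟨k, m, hk, hGk⟩ := hG.exists_eq_inter_hyperplane hne
  obtain ⟨l, c, hl, hFl⟩ := hF.exists_eq_inter_hyperplane (hne.mono hG.subset)
  obtain ⟨s, rfl⟩ := hT
  have hN : ∀ᶠ N : ℝ in atTop, ∀ v ∈ s, v ∉ F → N * l v + k v < N * c + m := by
    rw [Filter.eventually_all_finset]
    intro v hv
    by_cases hvF : v ∈ F
    · exact Filter.Eventually.of_forall fun _ h => absurd hvF h
    have hvT := subset_convexHull ℝ (s : Set E) hv
    have hlt : l v < c := lt_of_le_of_ne (hl v hvT) fun h => hvF (hFl ▸ ⟨hvT, h⟩)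
    filter_upwards [eventually_gt_atTop ((k v - m) / (c - l v))] with N hN _
    rw [div_lt_iff₀ (sub_pos.2 hlt)] at hN
    linarith
  obtain ⟨N, hN⟩ := hN.exists
  have hFval : ∀ v ∈ F, l v = c := fun v hv => (hFl ▸ hv : v ∈ _ ∩ {x | l x = c}).2
  have hGval : ∀ v ∈ F, k v = m → v ∈ G := fun v hv h => hGk ▸ ⟨hv, h⟩
  have hle : ∀ v ∈ s, (N • l + k) v ≤ N * c + m := by
    intro v hv
    by_cases hvF : v ∈ F
    · simpa [hFval v hvF] using hk v hvF
    · simpa using (hN v hv hvF).le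
  have heq : G = convexHull ℝ (s : Set E) ∩ {x | (N • l + k) x = N * c + m} := by
    refine Set.Subset.antisymm (fun x hx => ?_) ?_
    · have hxF := hG.subset hx
      have hxk : k x = m := (hGk ▸ hx : x ∈ F ∩ {x | k x = m}).2
      exact ⟨hF.subset hxF, by simp [hFval x hxF, hxk]⟩
    · rw [convexHull_inter_hyperplane s _ hle]
      refine convexHull_min ?_ (hG.convex (hF.convex (convex_convexHull ℝ _)))
      rintro v ⟨hv, hvc⟩
      have hvc' : N * l v + k v = N * c + m := by simpa using hvc
      by_cases hvF : v ∈ F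
      · refine hGval v hvF ?_
        rw [hFval v hvF] at hvc'
        linarith
      · exact absurd hvc' (hN v hv hvF).ne
  rw [heq]
  exact isExposed_inter_hyperplane fun y hy => le_of_mem_convexHull _ hle hy

/-- The algebraic relative interior of a convex set. -/
def relInt (F : Set E) : Set E :=
  {x | x ∈ F ∧ ∀ y ∈ F, ∃ ε : ℝ, 0 < ε ∧ x + ε • (x - y) ∈ F}

theorem relInt_subset (F : Set E) : relInt F ⊆ F := fun _ hx => hx.1

theorem _root_.Convex.add_smul_sub_mem_relInt {F : Set E} (hF : Convex ℝ F) {x p : E} (hx : x ∈ F)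
    (hp : p ∈ relInt F) {t : ℝ} (ht : 0 < t) (ht1 : t ≤ 1) : x + t • (p - x) ∈ relInt F := by
  refine ⟨hF.add_smul_sub_mem hx hp.1 ⟨ht.le, ht1⟩, fun y hy => ?_⟩
  obtain ⟨δ, hδ, h⟩ := hp.2 y hy
  have hD : 0 < δ + 1 - t * δ := by nlinarith
  -- Chosen so that the prolonged point is a convex combination of `x` and `p + δ • (p - y)`.
  refine ⟨t * δ / (δ + 1 - t * δ), by positivity, ?_⟩
  have h' := hF hx h (a := (1 - t) * (1 + t * δ / (δ + 1 - t * δ)))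
    (b := t / (δ + 1 - t * δ)) (mul_nonneg (by linarith) (by positivity)) (by positivity)
    (by field_simp; ring)
  convert h' using 1
  match_scalars
  · field_simp
    ring
  · field_simp
    ring
  · field_simp

theorem _root_.Convex.isRelOpenConvex_relInt {F : Set E} (hF : Convex ℝ F) :
    IsRelOpenConvex (relInt F) := by
  refine ⟨fun x hx y hy a b ha hb hab => ?_, fun x hx y hy => ?_⟩
  · rcases hb.eq_or_lt with rfl | hb'
    · simpa [show a = 1 by linarith] using hx
    · have := hF.add_smul_sub_mem_relInt hx.1 hy hb' (by linarith)
      convert this using 1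
      rw [show a = 1 - b by linarith]
      module
  · obtain ⟨ε, hε, h⟩ := hx.2 y hy.1
    refine ⟨ε / 2, by positivity, ?_⟩
    have := hF.add_smul_sub_mem_relInt h hx (t := 1 / 2) (by norm_num) (by norm_num)
    convert this using 1
    module

theorem _root_.Convex.vectorSpan_relInt {F : Set E} (hF : Convex ℝ F)
    (hne : (relInt F).Nonempty) : vectorSpan ℝ (relInt F) = vectorSpan ℝ F := by
  refine le_antisymm (vectorSpan_mono ℝ (relInt_subset F)) ?_
  obtain ⟨p, hp⟩ := hne
  rw [vectorSpan_eq_span_vsub_set_right ℝ hp.1, Submodule.span_le]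
  rintro _ ⟨y, hy, rfl⟩
  have h := vsub_mem_vectorSpan ℝ
    (hF.add_smul_sub_mem_relInt hy hp (t := 1 / 2) (by norm_num) (by norm_num)) hp
  have h2 := Submodule.smul_mem _ (2 : ℝ) h
  rwa [vsub_eq_sub, show (2 : ℝ) • (y + (1 / 2 : ℝ) • (p - y) - p) = y - p by module] at h2

/-- A functional bounded by `c` on `F` and equal to `c` at `x` is constant on each segment of `F`
through `x` that extends beyond `x`. -/
theorem subset_of_mem_relInt {T F G : Set E} (hG : IsExposed ℝ T G) (hF : F ⊆ T) {x : E}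
    (hx : x ∈ relInt F) (hxG : x ∈ G) : F ⊆ G := by
  obtain ⟨l, c, hl, rfl⟩ := hG.exists_eq_inter_hyperplane ⟨x, hxG⟩
  intro y hy
  obtain ⟨ε, hε, h⟩ := hx.2 y hy
  have h1 := hl _ (hF h)
  have h2 : l x = c := hxG.2
  have h3 := hl y (hF hy)
  refine ⟨hF hy, le_antisymm h3 ?_⟩
  simp only [map_add, map_smul, map_sub, smul_eq_mul, h2] at h1
  nlinarith

theorem vectorSpan_le_ker {F : Set E} {l : E →L[ℝ] ℝ} {c : ℝ} (h : ∀ x ∈ F, l x = c) :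
    vectorSpan ℝ F ≤ l.ker := by
  rw [vectorSpan_def, Submodule.span_le]
  rintro _ ⟨y, hy, z, hz, rfl⟩
  simp [h y hy, h z hz]

/-- A functional that is at most `c` on `s`, with equality on `F`, can be tilted by a functional
that is constant on `F` until a new point of `s` is reached. -/
theorem exists_tilt (s : Finset E) (l k : E →L[ℝ] ℝ) (c m : ℝ) (hl : ∀ v ∈ s, l v ≤ c)
    (heq : ∀ v ∈ s, l v = c → k v = m) (hk : ∃ v ∈ s, m < k v) :
    ∃ t : ℝ, 0 < t ∧ (∀ v ∈ s, (l + t • k) v ≤ c + t * m) ∧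
      ∃ v ∈ s, l v ≠ c ∧ (l + t • k) v = c + t * m := by
  classical
  obtain ⟨v₀, hv₀, hv₀'⟩ := hk
  -- Ratio test: the smallest quotient is the first `t` at which a point with `m < k v` reaches the
  -- tilted hyperplane.
  obtain ⟨v, hv, hmin⟩ := (s.filter (m < k ·)).exists_min_image (fun v => (c - l v) / (k v - m))
    ⟨v₀, Finset.mem_filter.2 ⟨hv₀, hv₀'⟩⟩
  rw [Finset.mem_filter] at hv
  have hlv : l v ≠ c := fun h => hv.2.ne' (heq v hv.1 h)
  have hpos := sub_pos.2 hv.2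
  have ht : 0 < (c - l v) / (k v - m) :=
    div_pos (sub_pos.2 (lt_of_le_of_ne (hl v hv.1) hlv)) hpos
  refine ⟨(c - l v) / (k v - m), ht, fun u hu => ?_, v, hv.1, hlv, ?_⟩
  · simp only [add_apply, smul_apply, smul_eq_mul]
    rcases lt_or_ge m (k u) with h | h
    · have := hmin u (Finset.mem_filter.2 ⟨hu, h⟩)
      rw [le_div_iff₀ (sub_pos.2 h)] at this
      linarith
    · have := hl u hu
      nlinarith
  · simp only [add_apply, smul_apply, smul_eq_mul]
    have : (c - l v) / (k v - m) * (k v - m) = c - l v := div_mul_cancel₀ _ hpos.ne'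
    linarith

theorem add_mem_relInt_of_mem_interior {F : Set E} {x : E} {V : Submodule ℝ E}
    (hV : ∀ y ∈ F, y - x ∈ V) {v : V} (hv : v ∈ interior ((fun v : V => x + (v : E)) ⁻¹' F)) :
    x + (v : E) ∈ relInt F := by
  refine ⟨(interior_subset hv : v ∈ (fun v : V => x + (v : E)) ⁻¹' F), fun y hy => ?_⟩
  have h1 : ∀ᶠ δ : ℝ in 𝓝[>] 0,
      v + δ • (v - ⟨y - x, hV y hy⟩) ∈ interior ((fun v : V => x + (v : E)) ⁻¹' F) := by
    refine Filter.Eventually.filter_mono nhdsWithin_le_nhds ?_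
    have : Tendsto (fun δ : ℝ => v + δ • (v - ⟨y - x, hV y hy⟩)) (𝓝 0)
        (𝓝 (v + (0 : ℝ) • (v - ⟨y - x, hV y hy⟩))) := Continuous.tendsto (by fun_prop) 0
    rw [zero_smul, add_zero] at this
    exact this.eventually (isOpen_interior.mem_nhds hv)
  obtain ⟨δ, h2, h3⟩ := (h1.and self_mem_nhdsWithin).exists
  refine ⟨δ, h3, ?_⟩
  have := interior_subset h2
  simp only [Set.mem_preimage, Submodule.coe_add, Submodule.coe_smul, Submodule.coe_sub] at this
  convert this using 1
  module

section FiniteDimensional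

variable [FiniteDimensional ℝ E]

theorem _root_.Convex.exists_interior_preimage {F : Set E} (hF : Convex ℝ F) {x : E}
    (hx : x ∈ F) : ∃ V : Submodule ℝ E, (∀ y ∈ F, y - x ∈ V) ∧
      Convex ℝ ((fun v : V => x + (v : E)) ⁻¹' F) ∧
      (interior ((fun v : V => x + (v : E)) ⁻¹' F)).Nonempty := by
  refine ⟨Submodule.span ℝ ((· - x) '' F), fun y hy => Submodule.subset_span ⟨y, hy, rfl⟩, ?_⟩
  set V := Submodule.span ℝ ((· - x) '' F) with hV
  have hA : Convex ℝ ((fun v : V => x + (v : E)) ⁻¹' F) := by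
    intro v hv w hw a b ha hb hab
    have := hF hv hw ha hb hab
    simp only [Set.mem_preimage, Submodule.coe_add, Submodule.coe_smul] at this ⊢
    convert this using 1
    rw [show a = 1 - b by linarith]
    module
  refine ⟨hA, ?_⟩
  have h0 : (0 : V) ∈ (fun v : V => x + (v : E)) ⁻¹' F := by simpa using hx
  rw [hA.interior_nonempty_iff_affineSpan_eq_top,
    AffineSubspace.affineSpan_eq_top_iff_vectorSpan_eq_top_of_nonempty ℝ V V ⟨0, h0⟩,
    vectorSpan_eq_span_vsub_set_right ℝ h0]
  have : ((fun v : V => x + (v : E)) ⁻¹' F) = (fun v : V => (v : E)) ⁻¹' ((· - x) '' F) := by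
    ext v
    simp only [Set.mem_preimage, Set.mem_image]
    exact ⟨fun h => ⟨_, h, by simp⟩, fun ⟨y, hy, hyv⟩ => by rw [← hyv]; simpa using hy⟩
  simp only [vsub_eq_sub, sub_zero, Set.image_id', this]
  exact Submodule.span_span_coe_preimage

theorem _root_.Convex.relInt_nonempty {F : Set E} (hF : Convex ℝ F) (hne : F.Nonempty) :
    (relInt F).Nonempty := by
  obtain ⟨x, hx⟩ := hne
  obtain ⟨V, hV, -, v, hv⟩ := hF.exists_interior_preimage hx
  exact ⟨_, add_mem_relInt_of_mem_interior hV hv⟩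

/-- Hahn–Banach is applied in a subspace where `F - x` has interior. The separation is strict on
that interior, so the hyperplane does not contain `F`. -/
theorem _root_.Convex.exists_support_of_notMem_relInt {F : Set E} (hF : Convex ℝ F) {x : E}
    (hx : x ∈ F) (hx' : x ∉ relInt F) :
    ∃ l : E →L[ℝ] ℝ, (∀ y ∈ F, l y ≤ l x) ∧ ∃ y ∈ F, l y < l x := by
  obtain ⟨V, hV, hA, hne⟩ := hF.exists_interior_preimage hx
  set A := (fun v : V => x + (v : E)) ⁻¹' F with hAdef
  have h0 : (0 : V) ∉ interior A := fun h =>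
    hx' (by simpa using add_mem_relInt_of_mem_interior hV h)
  obtain ⟨f, hf⟩ := geometric_hahn_banach_open_point hA.interior isOpen_interior h0
  obtain ⟨g, hg⟩ := LinearMap.exists_extend (f : V →ₗ[ℝ] ℝ)
  have hgf : ∀ v : V, g v = f v := fun v => LinearMap.congr_fun hg v
  have hle : ∀ v ∈ A, f v ≤ 0 := by
    intro v hv
    have h1 : v ∈ closure (interior A) := by
      rw [hA.closure_interior_eq_closure_of_nonempty_interior hne]
      exact subset_closure hv
    refine closure_minimal (fun w hw => ?_) (isClosed_le f.continuous continuous_const) h1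
    simpa using (hf w hw).le
  refine ⟨LinearMap.toContinuousLinearMap g, fun y hy => ?_, ?_⟩
  · have h1 := hle ⟨y - x, hV y hy⟩ (by simpa [hAdef] using hy)
    rw [← hgf, map_sub] at h1
    simpa using h1
  · obtain ⟨v, hv⟩ := hne
    have h1 := hf v hv
    rw [map_zero, ← hgf] at h1
    exact ⟨x + v, (interior_subset hv : v ∈ A), by simpa using h1⟩

/-- Take a minimal face containing `x`: were `x` outside its relative interior, a supporting
hyperplane at `x` would cut out a smaller one. -/
theorem IsConvexPolytope.exists_mem_relInt {T : Set E} (hT : IsConvexPolytope T) {x : E}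
    (hx : x ∈ T) : ∃ F, IsExposed ℝ T F ∧ x ∈ relInt F := by
  have hfin : {F | IsExposed ℝ T F ∧ x ∈ F}.Finite := hT.finite_faces.subset fun F hF => hF.1
  obtain ⟨F, hF⟩ := hfin.exists_minimal ⟨T, IsExposed.refl T, hx⟩
  refine ⟨F, hF.prop.1, ?_⟩
  by_contra hxF
  obtain ⟨l, hl, y, hy, hyx⟩ :=
    (hF.prop.1.convex hT.convex).exists_support_of_notMem_relInt hF.prop.2 hxF
  have h := hF.le_of_le (y := F ∩ {z | l z = l x})
    ⟨hT.isExposed_trans hF.prop.1 (isExposed_inter_hyperplane hl), hF.prop.2, rfl⟩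
    Set.inter_subset_left hy
  exact hyx.ne h.2

/-- A maximal proper face works: if its span were smaller than the hyperplane `l = 0` in the span of
`T`, the exposing functional could be tilted about `F` to expose a larger proper face. -/
theorem IsConvexPolytope.exists_facet {T : Set E} (hT : IsConvexPolytope T) {d : ℕ}
    (hd : Module.finrank ℝ (vectorSpan ℝ T) = d + 1) :
    ∃ F, IsExposed ℝ T F ∧ F.Nonempty ∧ Module.finrank ℝ (vectorSpan ℝ F) = d := by
  have hbot : vectorSpan ℝ T ≠ ⊥ := by
    intro h
    rw [h, finrank_bot] at hd
    omega
  have hTne : T.Nonempty := by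
    rw [Set.nonempty_iff_ne_empty]
    rintro rfl
    exact hbot (vectorSpan_empty ℝ E)
  have hcompact : IsCompact T := by
    obtain ⟨s, rfl⟩ := hT
    exact s.finite_toSet.isCompact_convexHull (𝕜 := ℝ)
  have hfin : {F | IsExposed ℝ T F ∧ F.Nonempty ∧ F ≠ T}.Finite :=
    hT.finite_faces.subset fun F hF => hF.1
  have hne : {F | IsExposed ℝ T F ∧ F.Nonempty ∧ F ≠ T}.Nonempty := by
    obtain ⟨w, hw, hw0⟩ := Submodule.exists_mem_ne_zero_of_ne_bot hbot
    obtain ⟨l, -, hl⟩ := exists_dual_vector ℝ w (norm_ne_zero_iff.2 hw0)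
    obtain ⟨x, hx, hmax⟩ := hcompact.exists_isMaxOn hTne l.continuous.continuousOn
    refine ⟨T ∩ {y | l y = l x}, isExposed_inter_hyperplane fun y hy => hmax hy, ⟨x, hx, rfl⟩,
      fun h => ?_⟩
    have hker := vectorSpan_le_ker (F := T) (l := l) (c := l x) 
      (fun y hy => (h.symm ▸ hy : y ∈ T ∩ {y | l y = l x}).2) hw
    have : l w = 0 := by simpa using hker
    rw [hl] at this
    exact hw0 (by simpa using this)
  obtain ⟨F, hF⟩ := hfin.exists_maximal hne
  obtain ⟨hFe, hFne, hFT⟩ := hF.prop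
  refine ⟨F, hFe, hFne, ?_⟩
  obtain ⟨l, c, hl, hFl⟩ := hFe.exists_eq_inter_hyperplane hFne
  have hFval : ∀ v ∈ F, l v = c := fun v hv => (hFl ▸ hv : v ∈ _ ∩ {x | l x = c}).2
  obtain ⟨p, hp⟩ := hFne
  have hlT : ∃ w ∈ vectorSpan ℝ T, l w ≠ 0 := by
    by_contra! h
    refine hFT (hFe.subset.antisymm fun y hy => ?_)
    rw [hFl]
    refine ⟨hy, ?_⟩
    have := h _ (vsub_mem_vectorSpan ℝ hy (hFe.subset hp))
    rw [vsub_eq_sub, map_sub, hFval p hp, sub_eq_zero] at this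
    exact this
  have hrank := finrank_inf_ker_add_one (vectorSpan ℝ T) l hlT
  have hFle : vectorSpan ℝ F ≤ vectorSpan ℝ T ⊓ l.ker :=
    le_inf (vectorSpan_mono ℝ hFe.subset) (vectorSpan_le_ker hFval)
  suffices vectorSpan ℝ F = vectorSpan ℝ T ⊓ l.ker by rw [this]; omega
  refine le_antisymm hFle ?_
  by_contra hnot
  obtain ⟨w, hw, hwF⟩ := SetLike.not_le_iff_exists.1 hnot
  obtain ⟨k, hkw, hkF⟩ := Submodule.exists_le_ker_of_notMem hwF
  -- Either `k` or `-k` exceeds its value on `F` somewhere on `T`, since `k w ≠ 0` prevents `k` from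
  -- being constant there.
  obtain ⟨k, hk0, hkF, hkpos⟩ : ∃ k : E →L[ℝ] ℝ, k w ≠ 0 ∧ vectorSpan ℝ F ≤ k.ker ∧
      ∃ y ∈ T, k p < k y := by
    by_contra! h
    have h1 := h (LinearMap.toContinuousLinearMap k) hkw hkF
    have h2 := h (-LinearMap.toContinuousLinearMap k) (by simpa using hkw)
      (fun v hv => by simpa using hkF hv)
    have h3 : ∀ y ∈ T, LinearMap.toContinuousLinearMap k y = LinearMap.toContinuousLinearMap k p :=
      fun y hy => le_antisymm (h1 y hy) (by simpa using h2 y hy)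
    exact hkw (by simpa using vectorSpan_le_ker h3 hw.1)
  obtain ⟨s, rfl⟩ := hT
  have hk : ∃ v ∈ s, k p < k v := by
    by_contra! h
    obtain ⟨y, hy, hky⟩ := hkpos
    exact hky.not_ge (le_of_mem_convexHull k h hy)
  have hkFval : ∀ v ∈ F, k v = k p := by
    intro v hv
    have := hkF (vsub_mem_vectorSpan ℝ hv hp)
    simpa [sub_eq_zero] using this
  obtain ⟨t, ht, hle, v, hv, hvc, hvt⟩ := exists_tilt s l k c (k p)
    (fun v hv => hl v (subset_convexHull ℝ _ hv))
    (fun v hv hvc => hkFval v (hFl ▸ ⟨subset_convexHull ℝ _ hv, hvc⟩)) hk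
  set G := convexHull ℝ (s : Set E) ∩ {x | (l + t • k) x = c + t * k p} with hG
  have hGe : IsExposed ℝ (convexHull ℝ (s : Set E)) G :=
    isExposed_inter_hyperplane fun y hy => le_of_mem_convexHull _ hle hy
  have hFG : F ⊆ G := fun x hx => ⟨hFe.subset hx, by simp [hFval x hx, hkFval x hx]⟩
  have hvG : v ∈ G := ⟨subset_convexHull ℝ _ hv, hvt⟩
  have hGT : G ≠ convexHull ℝ (s : Set E) := by
    intro h
    have h1 := vectorSpan_le_ker (F := convexHull ℝ (s : Set E)) (l := l + t • k)
      (c := c + t * k p) (fun y hy => (h.symm ▸ hy : y ∈ G).2) hw.1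
    have h2 : l w = 0 := by simpa using hw.2
    have h3 : t * k w = 0 := by simpa [h2] using h1
    exact hk0 ((mul_eq_zero.1 h3).resolve_left ht.ne')
  exact hvc (hFval v (hF.le_of_ge ⟨hGe, ⟨v, hvG⟩, hGT⟩ hFG hvG))

theorem IsConvexPolytope.exists_flag {T : Set E} (hT : IsConvexPolytope T) (hne : T.Nonempty)
    {n : ℕ} (hn : Module.finrank ℝ (vectorSpan ℝ T) = n) :
    ∃ c : ℕ → Set E, (∀ i ≤ n, IsExposed ℝ T (c i) ∧ (c i).Nonempty ∧
      Module.finrank ℝ (vectorSpan ℝ (c i)) = i) ∧ ∀ i j, i ≤ j → j ≤ n → c i ⊆ c j := by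
  induction n generalizing T with
  | zero =>
    refine ⟨fun _ => T, fun i hi => ?_, fun i j _ _ => subset_rfl⟩
    obtain rfl : i = 0 := by omega
    exact ⟨IsExposed.refl T, hne, hn⟩
  | succ n ih =>
    obtain ⟨F, hF, hFne, hFn⟩ := hT.exists_facet hn
    obtain ⟨c, hc, hmono⟩ := ih (hT.of_isExposed hF) hFne hFn
    obtain ⟨c', hc1, hc2⟩ : ∃ c' : ℕ → Set E, c' (n + 1) = T ∧ ∀ i ≤ n, c' i = c i :=
      ⟨Function.update c (n + 1) T, by simp, fun i hi => by simp [show i ≠ n + 1 by omega]⟩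
    refine ⟨c', fun i hi => ?_, fun i j hij hj => ?_⟩
    · rcases Nat.le_succ_iff.1 hi with h | rfl
      · rw [hc2 i h]
        exact ⟨hT.isExposed_trans hF (hc i h).1, (hc i h).2⟩
      · rw [hc1]
        exact ⟨IsExposed.refl T, hne, hn⟩
    · rcases Nat.le_succ_iff.1 hj with h | rfl
      · rw [hc2 i (hij.trans h), hc2 j h]
        exact hmono i j hij h
      · rcases Nat.le_succ_iff.1 hij with h | rfl
        · rw [hc2 i h, hc1]
          exact (hc i h).1.subset.trans hF.subset
        · exact subset_rfl

end FiniteDimensional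

end PolytopeTiling

/-! ### The partition into relative interiors and Euler's relation in a ball. -/

namespace PolytopeTiling

section Partition

variable {E : Type*} [NormedAddCommGroup E] [NormedSpace ℝ E] [FiniteDimensional ℝ E]
  {𝒯 : Set (Set E)}

theorem IsFaceToFaceTiling.exists_face_mem_relInt (h𝒯 : IsFaceToFaceTiling 𝒯) (x : E) :
    ∃ F, (∃ T ∈ 𝒯, IsExposed ℝ T F) ∧ x ∈ relInt F := by
  obtain ⟨T, hT, hx⟩ := h𝒯.sUnion_eq.symm ▸ Set.mem_univ x
  obtain ⟨F, hF, hxF⟩ := (h𝒯.isConvexPolytope T hT).exists_mem_relInt hx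
  exact ⟨F, ⟨T, hT, hF⟩, hxF⟩

omit [FiniteDimensional ℝ E] in
-- The common face `T ∩ T'` contains `x`, hence both `F` and `G`. So `G` is a face of `T ∩ T'`
-- meeting `relInt F`. By symmetry, faces whose relative interiors meet are equal.
theorem IsFaceToFaceTiling.subset_of_mem_relInt (h𝒯 : IsFaceToFaceTiling 𝒯) {x : E}
    {F G : Set E} (hF : ∃ T ∈ 𝒯, IsExposed ℝ T F) (hG : ∃ T ∈ 𝒯, IsExposed ℝ T G)
    (hxF : x ∈ relInt F) (hxG : x ∈ relInt G) : F ⊆ G := by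
  obtain ⟨T, hT, hF⟩ := hF
  obtain ⟨T', hT', hG⟩ := hG
  have hx : x ∈ T ∩ T' := ⟨hF.subset hxF.1, hG.subset hxG.1⟩
  obtain ⟨h1, h2⟩ := h𝒯.inter_face T hT T' hT'
  have hFT := PolytopeTiling.subset_of_mem_relInt h1 hF.subset hxF hx
  have hGT := PolytopeTiling.subset_of_mem_relInt h2 hG.subset hxG hx
  exact PolytopeTiling.subset_of_mem_relInt (hG.mono Set.inter_subset_right hGT) hFT hxF hxG.1

omit [FiniteDimensional ℝ E] in
theorem IsFaceToFaceTiling.isConvexPolytope_face (h𝒯 : IsFaceToFaceTiling 𝒯) {F : Set E}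
    (hF : ∃ T ∈ 𝒯, IsExposed ℝ T F) : IsConvexPolytope F := by
  obtain ⟨T, hT, hF⟩ := hF
  exact (h𝒯.isConvexPolytope T hT).of_isExposed hF

/-- A point of `F` in the ball can be moved slightly towards a relative interior point without
leaving the open ball. -/
theorem eulerChar_relInt_inter_ball {F : Set E} (hF : Convex ℝ F) {ρ : ℝ}
    (hne : (F ∩ Metric.ball 0 ρ).Nonempty) :
    eulerChar (relInt F ∩ Metric.ball 0 ρ) = (-1) ^ Module.finrank ℝ (vectorSpan ℝ F) := by
  obtain ⟨x, hx, hxρ⟩ := hne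
  obtain ⟨p, hp⟩ := hF.relInt_nonempty ⟨x, hx⟩
  have h1 : ∀ᶠ t : ℝ in 𝓝[>] 0, x + t • (p - x) ∈ Metric.ball (0 : E) ρ := by
    refine Filter.Eventually.filter_mono nhdsWithin_le_nhds ?_
    have : Tendsto (fun t : ℝ => x + t • (p - x)) (𝓝 0) (𝓝 (x + (0 : ℝ) • (p - x))) :=
      Continuous.tendsto (by fun_prop) 0
    rw [zero_smul, add_zero] at this
    exact this.eventually (Metric.isOpen_ball.mem_nhds hxρ)
  obtain ⟨t, h2, h3, h4⟩ := (h1.and (Ioo_mem_nhdsGT one_pos)).exists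
  have hne : (relInt F ∩ Metric.ball 0 ρ).Nonempty :=
    ⟨_, hF.add_smul_sub_mem_relInt hx hp h3 h4.le, h2⟩
  rw [eulerChar, if_pos hne,
    hF.isRelOpenConvex_relInt.vectorSpan_inter_open Metric.isOpen_ball hne,
    hF.vectorSpan_relInt ⟨p, hp⟩]

omit [FiniteDimensional ℝ E] in
theorem vectorSpan_eq_top_of_interior_nonempty {T : Set E} (hT : (interior T).Nonempty) :
    vectorSpan ℝ T = ⊤ := by
  rw [← direction_affineSpan, affineSpan_eq_top_of_nonempty_interior
    (hT.mono (interior_mono (subset_convexHull ℝ T))), AffineSubspace.direction_top]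

omit [FiniteDimensional ℝ E] in
theorem isRelOpenConvex_of_isOpen {U : Set E} (hU : IsOpen U) (hU' : Convex ℝ U) :
    IsRelOpenConvex U := by
  have : IsRelOpenConvex (Set.univ : Set E) := ⟨convex_univ, fun _ _ _ _ => ⟨1, one_pos, trivial⟩⟩
  simpa using this.inter_open hU hU'

omit [FiniteDimensional ℝ E] in
theorem eulerChar_ball {ρ : ℝ} (hρ : 0 < ρ) :
    eulerChar (Metric.ball (0 : E) ρ) = (-1) ^ Module.finrank ℝ E := by
  rw [eulerChar, if_pos ⟨0, by simpa⟩, vectorSpan_eq_top_of_interior_nonempty, finrank_top]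
  rw [Metric.isOpen_ball.interior_eq]
  exact ⟨0, by simpa⟩

/-- Euler's relation for the faces of a tiling that meet an open ball. -/
theorem IsFaceToFaceTiling.sum_neg_one_pow (h𝒯 : IsFaceToFaceTiling 𝒯) {ρ : ℝ} (hρ : 0 < ρ)
    (J : Finset (Set E))
    (hJ : ∀ F, F ∈ J ↔ (∃ T ∈ 𝒯, IsExposed ℝ T F) ∧ (F ∩ Metric.ball 0 ρ).Nonempty) :
    ∑ F ∈ J, (-1 : ℤ) ^ Module.finrank ℝ (vectorSpan ℝ F) = (-1) ^ Module.finrank ℝ E := by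
  have hconv : ∀ F ∈ J, Convex ℝ F := fun F hF =>
    (h𝒯.isConvexPolytope_face ((hJ F).1 hF).1).convex
  -- The index `none` stands for the whole ball, with coefficient `-1`; the pieces `relInt F ∩ ball`
  -- have coefficient `1`.
  have key := sum_mul_eulerChar_eq_zero (Finset.insertNone J) (fun o => o.elim (-1) fun _ => 1)
    (fun o => o.elim (Metric.ball (0 : E) ρ) fun F => relInt F ∩ Metric.ball 0 ρ) ?_ ?_ ?_
  · simp only [Finset.sum_insertNone, Option.elim_none, Option.elim_some, one_mul,
      eulerChar_ball hρ] at key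
    rw [Finset.sum_congr rfl fun F hF =>
      eulerChar_relInt_inter_ball (hconv F hF) ((hJ F).1 hF).2] at key
    linarith
  · rw [Finset.forall_mem_insertNone]
    exact ⟨isRelOpenConvex_of_isOpen Metric.isOpen_ball (convex_ball 0 ρ), fun F hF =>
      (hconv F hF).isRelOpenConvex_relInt.inter_open Metric.isOpen_ball (convex_ball 0 ρ)⟩
  · rw [Finset.forall_mem_insertNone]
    exact ⟨Metric.isBounded_ball, fun F _ => Metric.isBounded_ball.subset Set.inter_subset_right⟩
  · intro x
    simp only [Finset.sum_insertNone, Option.elim_none, Option.elim_some]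
    by_cases hx : x ∈ Metric.ball (0 : E) ρ
    · obtain ⟨F, hF, hxF⟩ := h𝒯.exists_face_mem_relInt x
      have hFJ : F ∈ J := (hJ F).2 ⟨hF, x, hxF.1, hx⟩
      rw [Finset.sum_eq_single_of_mem F hFJ, Set.indicator_of_mem hx,
        Set.indicator_of_mem (show x ∈ relInt F ∩ Metric.ball 0 ρ from ⟨hxF, hx⟩)]
      · norm_num
      · intro G hG hGF
        refine Set.indicator_of_notMem (fun hxG => hGF ?_) _
        exact (h𝒯.subset_of_mem_relInt ((hJ G).1 hG).1 hF hxG.1 hxF).antisymm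
          (h𝒯.subset_of_mem_relInt hF ((hJ G).1 hG).1 hxF hxG.1)
    · rw [Set.indicator_of_notMem hx, zero_add]
      exact Finset.sum_eq_zero fun F _ => Set.indicator_of_notMem (fun h => hx h.2) _

end Partition

/-! ### Finiteness of the counts and the bound `1/2`. -/

section Finiteness

variable {E : Type*} [NormedAddCommGroup E] [NormedSpace ℝ E] [FiniteDimensional ℝ E]
  {𝒯 : Set (Set E)}

omit [FiniteDimensional ℝ E] in
/-- The tiles of a normal tiling have uniformly bounded size. -/
theorem IsNormalTiling.exists_dist_le (h𝒯 : IsNormalTiling 𝒯) :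
    ∃ D, 0 ≤ D ∧ ∀ T ∈ 𝒯, ∀ x ∈ T, ∀ y ∈ T, dist x y ≤ D := by
  obtain ⟨R, hR⟩ := h𝒯.circumradius_bound
  refine ⟨max (2 * R) 0, le_max_right _ _, fun T hT x hx y hy => ?_⟩
  obtain ⟨z, hz⟩ := hR T hT
  have h1 := hz hx
  have h2 := hz hy
  rw [Metric.mem_closedBall] at h1 h2
  exact ((dist_triangle_right x y z).trans (by linarith)).trans (le_max_left _ _)

/-- Packing: the interiors are disjoint, each contains a ball of radius `r`, and all lie in a ball
of finite volume. -/
theorem IsNormalTiling.finite_tiles_meeting (h𝒯 : IsNormalTiling 𝒯) (ρ : ℝ) :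
    {T ∈ 𝒯 | (T ∩ Metric.ball 0 ρ).Nonempty}.Finite := by
  obtain ⟨r, hr, hrT⟩ := h𝒯.inradius_bound
  obtain ⟨D, -, hD⟩ := h𝒯.exists_dist_le
  borelize E
  let μ : MeasureTheory.Measure E := MeasureTheory.Measure.addHaar
  set 𝒮 := {T ∈ 𝒯 | (T ∩ Metric.ball 0 ρ).Nonempty}
  have hfin : {T : 𝒮 | μ (Metric.ball 0 r) ≤ μ (interior T.1)}.Finite := by
    refine MeasureTheory.Measure.finite_const_le_meas_of_disjoint_iUnion μ
      (Metric.measure_ball_pos μ 0 hr) (fun T => isOpen_interior.measurableSet) ?_ ?_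
    · intro T T' hne
      exact h𝒯.disjoint_interior T.2.1 T'.2.1 fun h => hne (Subtype.ext h)
    · refine ne_top_of_le_ne_top
        (MeasureTheory.measure_ball_lt_top (μ := μ) (x := 0) (r := ρ + D + 1)).ne
        (MeasureTheory.measure_mono (Set.iUnion_subset fun T x hx => ?_))
      obtain ⟨y, hy, hyρ⟩ := T.2.2
      have h1 := hD T T.2.1 x (interior_subset hx) y hy
      rw [Metric.mem_ball] at hyρ ⊢
      linarith [dist_triangle x y 0]
  have huniv : {T : 𝒮 | μ (Metric.ball 0 r) ≤ μ (interior T.1)} = Set.univ := by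
    refine Set.eq_univ_of_forall fun T => ?_
    obtain ⟨x, hx⟩ := hrT T T.2.1
    have h1 : Metric.ball x r ⊆ interior T.1 :=
      interior_maximal (Metric.ball_subset_closedBall.trans hx) Metric.isOpen_ball
    calc μ (Metric.ball 0 r) = μ (Metric.ball x r) :=
          (MeasureTheory.Measure.addHaar_ball_center μ x r).symm
      _ ≤ _ := MeasureTheory.measure_mono h1
  rw [huniv] at hfin
  exact Set.finite_coe_iff.1 (Set.finite_univ_iff.1 hfin)

theorem IsNormalTiling.finite_faces_meeting (h𝒯 : IsNormalTiling 𝒯) (ρ : ℝ) :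
    {F | (∃ T ∈ 𝒯, IsExposed ℝ T F) ∧ (F ∩ Metric.ball 0 ρ).Nonempty}.Finite := by
  refine ((h𝒯.finite_tiles_meeting ρ).biUnion (t := fun T => {F | IsExposed ℝ T F})
    fun T hT => (h𝒯.isConvexPolytope T hT.1).finite_faces).subset ?_
  rintro F ⟨⟨T, hT, hF⟩, hne⟩
  exact Set.mem_biUnion (x := T)
    ⟨hT, hne.mono (Set.inter_subset_inter_left _ hF.subset)⟩ hF

theorem IsNormalTiling.finite_facesMeeting (h𝒯 : IsNormalTiling 𝒯) (i : ℕ) (ρ : ℝ) :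
    (facesMeeting 𝒯 i ρ).Finite :=
  (h𝒯.finite_faces_meeting ρ).subset fun _ hF => ⟨hF.1, hF.2.2⟩

theorem IsNormalTiling.euler_relation (h𝒯 : IsNormalTiling 𝒯) {ρ : ℝ} (hρ : 0 < ρ) :
    ∑ i ∈ Finset.range (Module.finrank ℝ E + 1), (-1 : ℤ) ^ i * (faceCount 𝒯 i ρ : ℤ) =
      (-1) ^ Module.finrank ℝ E := by
  classical
  set J := (h𝒯.finite_faces_meeting ρ).toFinset with hJ
  rw [← h𝒯.toIsFaceToFaceTiling.sum_neg_one_pow hρ J (by simp [hJ]),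
    ← Finset.sum_fiberwise_of_maps_to (s := J) (t := Finset.range (Module.finrank ℝ E + 1))
      (g := fun F => Module.finrank ℝ (vectorSpan ℝ F))
      fun F _ => Finset.mem_range.2 (Nat.lt_succ_of_le (Submodule.finrank_le _))]
  refine Finset.sum_congr rfl fun i _ => ?_
  have hcard : faceCount 𝒯 i ρ = (J.filter fun F => Module.finrank ℝ (vectorSpan ℝ F) = i).card := by
    rw [faceCount, ← Set.ncard_coe_finset]
    congr 1
    ext F
    simp [hJ, facesMeeting]
    tauto
  rw [Finset.sum_congr rfl fun F hF => by rw [(Finset.mem_filter.1 hF).2], Finset.sum_const, hcard,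
    nsmul_eq_mul, mul_comm]

omit [FiniteDimensional ℝ E] in
theorem IsFaceToFaceTiling.tile_mem_facesMeeting (h𝒯 : IsFaceToFaceTiling 𝒯) {T : Set E}
    (hT : T ∈ 𝒯) {ρ : ℝ} (hne : (T ∩ Metric.ball 0 ρ).Nonempty) :
    T ∈ facesMeeting 𝒯 (Module.finrank ℝ E) ρ :=
  ⟨⟨T, hT, IsExposed.refl T⟩, by
    rw [vectorSpan_eq_top_of_interior_nonempty (h𝒯.interior_nonempty T hT), finrank_top], hne⟩

omit [FiniteDimensional ℝ E] in
theorem IsFaceToFaceTiling.infinite [Nontrivial E] (h𝒯 : IsFaceToFaceTiling 𝒯) : 𝒯.Infinite := by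
  intro hfin
  refine NormedSpace.unbounded_univ ℝ E ?_
  rw [← h𝒯.sUnion_eq]
  exact (Bornology.isBounded_sUnion hfin).2 fun T hT => (h𝒯.isConvexPolytope T hT).isBounded

theorem IsNormalTiling.tendsto_sum_faceCount [Nontrivial E] (h𝒯 : IsNormalTiling 𝒯) :
    Tendsto (fun ρ : ℝ => ∑ j ∈ Finset.range (Module.finrank ℝ E + 1), (faceCount 𝒯 j ρ : ℝ))
      atTop atTop := by
  rw [tendsto_atTop]
  intro b
  obtain ⟨k, hk⟩ := exists_nat_ge b
  obtain ⟨t, ht, htk⟩ := h𝒯.toIsFaceToFaceTiling.infinite.exists_subset_card_eq k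
  have hev : ∀ᶠ ρ : ℝ in atTop, ∀ T ∈ t, (T ∩ Metric.ball 0 ρ).Nonempty := by
    rw [Filter.eventually_all_finset]
    intro T hT
    obtain ⟨x, hx⟩ := h𝒯.interior_nonempty T (ht hT)
    filter_upwards [eventually_gt_atTop ‖x‖] with ρ hρ
    exact ⟨x, interior_subset hx, by simpa⟩
  filter_upwards [hev] with ρ hρ
  have h1 : k ≤ faceCount 𝒯 (Module.finrank ℝ E) ρ := by
    rw [← htk, ← Set.ncard_coe_finset]
    exact Set.ncard_le_ncard (fun T hT => h𝒯.tile_mem_facesMeeting (ht hT) (hρ T hT))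
      (h𝒯.finite_facesMeeting _ _)
  calc b ≤ k := hk
    _ ≤ (faceCount 𝒯 (Module.finrank ℝ E) ρ : ℝ) := by exact_mod_cast h1
    _ ≤ _ := Finset.single_le_sum (f := fun j => (faceCount 𝒯 j ρ : ℝ))
      (fun j _ => Nat.cast_nonneg _) (Finset.self_mem_range_succ _)

/-- The weights `1 + (-1)^i (-1)^j` are `0` or `2`, and `2` at `j = i`. Hence twice the `i`-th count
is at most the total plus `(-1)^i (-1)^n`, and the total tends to infinity. -/
theorem IsNormalTiling.limit_le_half [Nontrivial E] (h𝒯 : IsNormalTiling 𝒯) {i : ℕ}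
    (hi : i ≤ Module.finrank ℝ E) {φ : ℝ}
    (h : Tendsto (fun ρ : ℝ => (faceCount 𝒯 i ρ : ℝ) /
      ∑ j ∈ Finset.range (Module.finrank ℝ E + 1), (faceCount 𝒯 j ρ : ℝ)) atTop (𝓝 φ)) :
    0 ≤ φ ∧ φ ≤ 1 / 2 := by
  refine ⟨ge_of_tendsto' h fun ρ => by positivity, ?_⟩
  set n := Module.finrank ℝ E
  have hN := h𝒯.tendsto_sum_faceCount
  have hlim : Tendsto (fun ρ : ℝ =>
      1 / 2 + 1 / 2 * (∑ j ∈ Finset.range (n + 1), (faceCount 𝒯 j ρ : ℝ))⁻¹) atTop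
      (𝓝 (1 / 2 + 1 / 2 * 0)) := (hN.inv_tendsto_atTop.const_mul _).const_add _
  rw [mul_zero, add_zero] at hlim
  refine le_of_tendsto_of_tendsto h hlim ?_
  filter_upwards [eventually_gt_atTop 0, hN.eventually_gt_atTop 0] with ρ hρ hNρ
  have heuler : ∑ j ∈ Finset.range (n + 1), (-1 : ℝ) ^ j * (faceCount 𝒯 j ρ : ℝ) = (-1) ^ n := by
    exact_mod_cast h𝒯.euler_relation hρ
  have hsingle := Finset.single_le_sum
    (f := fun j => (1 + (-1 : ℝ) ^ i * (-1) ^ j) * (faceCount 𝒯 j ρ : ℝ)) (s := Finset.range (n + 1))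
    (fun j _ => mul_nonneg (by
      rcases neg_one_pow_eq_or ℝ i with h | h <;> rcases neg_one_pow_eq_or ℝ j with h' | h' <;>
        rw [h, h'] <;> norm_num) (Nat.cast_nonneg _)) (Finset.mem_range.2 (Nat.lt_succ_of_le hi))
  simp only [add_mul, one_mul, Finset.sum_add_distrib, mul_assoc, ← Finset.mul_sum,
    heuler] at hsingle
  have h1 : (-1 : ℝ) ^ i * ((-1) ^ i * (faceCount 𝒯 i ρ : ℝ)) = faceCount 𝒯 i ρ := by
    rw [← mul_assoc, ← mul_pow]; norm_num
  have h2 : (-1 : ℝ) ^ i * (-1) ^ n ≤ 1 := by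
    rcases neg_one_pow_eq_or ℝ i with h | h <;> rcases neg_one_pow_eq_or ℝ n with h' | h' <;>
        rw [h, h'] <;> norm_num
  rw [h1] at hsingle
  rw [div_le_iff₀ hNρ, add_mul, mul_assoc, inv_mul_cancel₀ hNρ.ne']
  linarith

end Finiteness

end PolytopeTiling

/-! ### Lattice points and lattice orbits in large balls. -/

namespace PolytopeTiling

open scoped Pointwise

section Translation

variable {E : Type*} [NormedAddCommGroup E] [NormedSpace ℝ E]

theorem _root_.IsExposed.vadd {T F : Set E} (hF : IsExposed ℝ T F) (v : E) :
    IsExposed ℝ (v +ᵥ T) (v +ᵥ F) := by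
  rintro hne
  obtain ⟨l, hl⟩ := hF (by simpa using hne)
  refine ⟨l, Set.ext fun x => ?_⟩
  obtain ⟨x, rfl⟩ : ∃ y, x = v +ᵥ y := ⟨-v +ᵥ x, by simp⟩
  rw [Set.vadd_mem_vadd_set_iff, hl]
  refine ⟨fun h => ⟨Set.vadd_mem_vadd_set h.1, ?_⟩,
    fun h => ⟨Set.vadd_mem_vadd_set_iff.1 h.1, fun y hy => ?_⟩⟩
  · rintro _ ⟨y, hy, rfl⟩
    simpa using h.2 y hy
  · simpa using h.2 _ (Set.vadd_mem_vadd_set (a := v) hy)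

/-- Otherwise `F` would contain the unbounded sequence `x + k • (v - w)`. This makes lattice vectors
and translates of a face correspond bijectively. -/
theorem eq_of_vadd_eq_vadd_of_isBounded {F : Set E} (hb : Bornology.IsBounded F)
    (hne : F.Nonempty) {v w : E} (h : v +ᵥ F = w +ᵥ F) : v = w := by
  obtain ⟨x, hx⟩ := hne
  have hmem : ∀ k : ℕ, x + (k : ℝ) • (v - w) ∈ F := by
    intro k
    induction k with
    | zero => simpa using hx
    | succ k ih =>
      have h1 : v +ᵥ (x + (k : ℝ) • (v - w)) ∈ w +ᵥ F := h ▸ Set.vadd_mem_vadd_set ih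
      obtain ⟨y, hy, hyx⟩ := h1
      convert hy using 1
      have hyx' : w + y = v + (x + (k : ℝ) • (v - w)) := hyx
      rw [← add_right_inj w, hyx']
      push_cast
      module
  obtain ⟨D, hD⟩ := Metric.isBounded_iff.1 hb
  by_contra hne
  obtain ⟨k, hk⟩ := exists_nat_gt (D / ‖v - w‖)
  rw [div_lt_iff₀ (norm_pos_iff.2 (sub_ne_zero.2 hne))] at hk
  have h1 := hD (hmem k) hx
  rw [dist_eq_norm, add_sub_cancel_left, norm_smul, Real.norm_natCast] at h1
  linarith

end Translation

section LatticeCount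

variable {E : Type*} [NormedAddCommGroup E] [InnerProductSpace ℝ E] [FiniteDimensional ℝ E]
  [MeasurableSpace E] [BorelSpace E] (L : Submodule ℤ E) [DiscreteTopology L]

omit [MeasurableSpace E] [BorelSpace E] in
theorem finite_lattice_inter {s : Set E} (hs : Bornology.IsBounded s) :
    ((L : Set E) ∩ s).Finite := by
  have : IsClosed (L : Set E) := AddSubgroup.isClosed_of_discrete (H := L.toAddSubgroup)
  rw [Set.inter_comm]
  exact Metric.finite_isBounded_inter_isClosed DiscreteTopology.isDiscrete hs this

variable [IsZLattice ℝ L]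

/-- The number of lattice points per unit of radius to the power of the dimension. -/
noncomputable def latticeDensity : ℝ :=
  MeasureTheory.volume.real (Metric.closedBall (0 : E) 1) / ZLattice.covolume L

theorem latticeDensity_pos : 0 < latticeDensity L := by
  refine div_pos ?_ (ZLattice.covolume_pos L MeasureTheory.volume)
  exact ENNReal.toReal_pos (Metric.measure_closedBall_pos _ _ one_pos).ne'
    MeasureTheory.measure_closedBall_lt_top.ne

theorem tendsto_lattice_count [Nontrivial E] :
    Tendsto (fun ρ : ℝ => (((L : Set E) ∩ Metric.closedBall 0 ρ).ncard : ℝ) /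
      ρ ^ Module.finrank ℝ E) atTop (𝓝 (latticeDensity L)) := by
  have hn : Module.finrank ℝ E ≠ 0 := Module.finrank_pos.ne'
  have hset : ∀ ρ : ℝ, 0 ≤ ρ → {x ∈ (Set.univ : Set E) | ‖x‖ ^ Module.finrank ℝ E ≤
      ρ ^ Module.finrank ℝ E} = Metric.closedBall 0 ρ := by
    intro ρ hρ
    ext x
    simp [pow_le_pow_iff_left₀ (norm_nonneg x) hρ hn]
  have hset1 := hset 1 zero_le_one
  rw [one_pow] at hset1
  -- The function `‖x‖ ^ n` is homogeneous of degree `n`, and its sublevel set at `ρ ^ n` is the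
  -- closed ball of radius `ρ`.
  have key := ZLattice.covolume.tendsto_card_le_div' L (X := Set.univ)
    (F := fun x : E => ‖x‖ ^ Module.finrank ℝ E) (fun _ _ _ _ => trivial)
    (fun x r hr => by rw [norm_smul, mul_pow, Real.norm_of_nonneg hr])
    (by rw [hset1]; exact Metric.isBounded_closedBall)
    (by rw [hset1]; exact measurableSet_closedBall)
    (by rw [hset1]; exact (convex_closedBall (0 : E) 1).addHaar_frontier _)
  rw [hset1] at key
  refine (key.comp (tendsto_pow_atTop hn)).congr' ?_
  filter_upwards [eventually_ge_atTop 0] with ρ hρ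
  simp only [Function.comp_apply]
  rw [hset ρ hρ, Set.inter_comm, Nat.card_coe_set_eq]

theorem tendsto_lattice_count_add [Nontrivial E] (D : ℝ) :
    Tendsto (fun ρ : ℝ => (((L : Set E) ∩ Metric.closedBall 0 (ρ + D)).ncard : ℝ) /
      ρ ^ Module.finrank ℝ E) atTop (𝓝 (latticeDensity L)) := by
  have h1 := (tendsto_lattice_count L).comp (tendsto_atTop_add_const_right atTop D tendsto_id)
  have h2 : Tendsto (fun ρ : ℝ => (1 + D * ρ⁻¹) ^ Module.finrank ℝ E) atTop (𝓝 1) := by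
    have := ((tendsto_inv_atTop_zero (𝕜 := ℝ)).const_mul D |>.const_add 1).pow (Module.finrank ℝ E)
    simpa using this
  have h3 := h1.mul h2
  rw [mul_one] at h3
  refine h3.congr' ?_
  filter_upwards [eventually_gt_atTop 0, eventually_gt_atTop (-D)] with ρ hρ hρD
  have h4 : 0 < ρ + D := by linarith
  have h5 : 1 + D * ρ⁻¹ = (ρ + D) / ρ := by field_simp
  simp only [Function.comp_apply, id, h5, div_pow]
  field_simp

/-- The number of lattice translates of a family of bounded sets all of whose members meet a ball
of radius `ρ`. -/
theorem tendsto_translate_count [Nontrivial E] {ι : Type*} [Finite ι] [Nonempty ι] (q : ι → Set E)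
    (hne : ∀ i, (q i).Nonempty) (hb : ∀ i, Bornology.IsBounded (q i)) :
    Tendsto (fun ρ : ℝ =>
      ({v : E | v ∈ L ∧ ∀ i, ((v +ᵥ q i) ∩ Metric.ball 0 ρ).Nonempty}.ncard : ℝ) /
        ρ ^ Module.finrank ℝ E) atTop (𝓝 (latticeDensity L)) := by
  obtain ⟨D, hD⟩ := (Bornology.isBounded_iUnion.2 hb).exists_norm_le
  have hD' : ∀ i, ∀ x ∈ q i, ‖x‖ ≤ D := fun i x hx => hD x (Set.mem_iUnion.2 ⟨i, hx⟩)
  have hupper : ∀ ρ, {v : E | v ∈ L ∧ ∀ i, ((v +ᵥ q i) ∩ Metric.ball 0 ρ).Nonempty} ⊆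
      (L : Set E) ∩ Metric.closedBall 0 (ρ + D) := by
    rintro ρ v ⟨hv, h⟩
    obtain ⟨i⟩ := ‹Nonempty ι›
    obtain ⟨_, ⟨x, hx, rfl⟩, hxρ⟩ := h i
    refine ⟨hv, ?_⟩
    simp only [vadd_eq_add, mem_ball_zero_iff] at hxρ
    rw [mem_closedBall_zero_iff]
    have := norm_sub_le (v + x) x
    rw [add_sub_cancel_right] at this
    linarith [hD' i x hx]
  -- The extra `-1` gives the strict inequality that the open ball requires.
  have hlower : ∀ ρ, (L : Set E) ∩ Metric.closedBall 0 (ρ + (-D - 1)) ⊆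
      {v : E | v ∈ L ∧ ∀ i, ((v +ᵥ q i) ∩ Metric.ball 0 ρ).Nonempty} := by
    rintro ρ v ⟨hv, h⟩
    refine ⟨hv, fun i => ?_⟩
    obtain ⟨x, hx⟩ := hne i
    refine ⟨_, Set.vadd_mem_vadd_set hx, ?_⟩
    rw [mem_closedBall_zero_iff] at h
    rw [vadd_eq_add, mem_ball_zero_iff]
    linarith [norm_add_le v x, hD' i x hx]
  have hfin : ∀ r, ((L : Set E) ∩ Metric.closedBall 0 r).Finite := fun r =>
    finite_lattice_inter L Metric.isBounded_closedBall
  refine tendsto_of_tendsto_of_tendsto_of_le_of_le' (tendsto_lattice_count_add L (-D - 1))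
    (tendsto_lattice_count_add L D) ?_ ?_
  · filter_upwards [eventually_gt_atTop 0] with ρ hρ
    gcongr
    · exact (hfin _).subset (hupper ρ)
    · exact hlower ρ
  · filter_upwards [eventually_gt_atTop 0] with ρ hρ
    gcongr
    · exact hfin _
    · exact hupper ρ

/-- The asymptotic number of members, meeting a large ball, of a lattice-invariant set of families
of bounded sets that has finitely many orbits. -/
theorem tendsto_orbit_count [Nontrivial E] {ι : Type*} [Finite ι] [Nonempty ι]
    (X B : Set (ι → Set E)) (hinv : ∀ v ∈ L, ∀ c ∈ X, v +ᵥ c ∈ X)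
    (hne : ∀ c ∈ X, ∀ i, (c i).Nonempty) (hb : ∀ c ∈ X, ∀ i, Bornology.IsBounded (c i))
    (hB : B.Finite) (hXB : ∀ c ∈ X, ∃ v ∈ L, v +ᵥ c ∈ B) (hBX : B ⊆ X) :
    ∃ m : ℕ, Tendsto (fun ρ : ℝ =>
      ({c | c ∈ X ∧ ∀ i, (c i ∩ Metric.ball 0 ρ).Nonempty}.ncard : ℝ) /
        ρ ^ Module.finrank ℝ E) atTop (𝓝 (m * latticeDensity L)) ∧ (X.Nonempty → 0 < m) := by
  let r : Setoid (ι → Set E) :=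
    { r := fun c c' => ∃ v ∈ L, v +ᵥ c = c'
      iseqv := ⟨fun c => ⟨0, L.zero_mem, zero_vadd _ _⟩,
        fun ⟨v, hv, h⟩ => ⟨-v, L.neg_mem hv, by rw [← h, neg_vadd_vadd]⟩,
        fun ⟨v, hv, h⟩ ⟨w, hw, h'⟩ => ⟨w + v, L.add_mem hw hv, by rw [← h', ← h, add_vadd]⟩⟩ }
  -- One fixed representative per orbit. As `B` meets every orbit of `X`, the representatives `Q` of
  -- members of `B` are finite in number and exhaust these orbits; the constant `m` is their number.
  let rep : (ι → Set E) → (ι → Set E) := fun c => (Quotient.mk r c).out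
  have hrep : ∀ c, ∃ v ∈ L, v +ᵥ rep c = c := fun c =>
    Quotient.exact (Quotient.out_eq (Quotient.mk r c))
  have hrep_eq : ∀ c v, v ∈ L → rep (v +ᵥ c) = rep c := fun c v hv =>
    congrArg Quotient.out (Quotient.sound (s := r)
      (show ∃ w ∈ L, w +ᵥ (v +ᵥ c) = c from ⟨-v, L.neg_mem hv, neg_vadd_vadd v c⟩))
  have hrep_rep : ∀ c, rep (rep c) = rep c := fun c => by
    obtain ⟨v, hv, h⟩ := hrep c
    conv_rhs => rw [← h, hrep_eq _ _ hv]
  have hrepX : ∀ c ∈ X, rep c ∈ X := fun c hc => by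
    obtain ⟨v, hv, h⟩ := hrep c
    have := hinv (-v) (L.neg_mem hv) c hc
    rwa [← h, neg_vadd_vadd] at this
  have hQ : (rep '' B).Finite := hB.image _
  let Q := hQ.toFinset
  have hQX : ∀ q ∈ Q, q ∈ X := fun q hq => by
    obtain ⟨c, hc, rfl⟩ := hQ.mem_toFinset.1 hq
    exact hrepX c (hBX hc)
  have hQrep : ∀ q ∈ Q, rep q = q := fun q hq => by
    obtain ⟨c, hc, rfl⟩ := hQ.mem_toFinset.1 hq
    exact hrep_rep c
  have hXQ : ∀ c ∈ X, rep c ∈ Q := fun c hc => by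
    obtain ⟨v, hv, h⟩ := hXB c hc
    rw [hQ.mem_toFinset]
    exact ⟨_, h, hrep_eq _ _ hv⟩
  refine ⟨Q.card, ?_, fun ⟨c, hc⟩ => Finset.card_pos.2 ⟨_, hXQ c hc⟩⟩
  have hcount : ∀ ρ : ℝ, {c | c ∈ X ∧ ∀ i, (c i ∩ Metric.ball 0 ρ).Nonempty}.ncard =
      ∑ q ∈ Q, {v : E | v ∈ L ∧ ∀ i, ((v +ᵥ q i) ∩ Metric.ball 0 ρ).Nonempty}.ncard := by
    intro ρ
    -- Each member is `v +ᵥ q` for exactly one pair: `q` is determined by the orbit, `v` by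
    -- boundedness.
    have hunion : {c | c ∈ X ∧ ∀ i, (c i ∩ Metric.ball 0 ρ).Nonempty} = ⋃ q ∈ (Q : Set (ι → Set E)),
        (fun v : E => v +ᵥ q) '' {v : E | v ∈ L ∧ ∀ i, ((v +ᵥ q i) ∩ Metric.ball 0 ρ).Nonempty} := by
      ext c
      simp only [Set.mem_iUnion, Set.mem_image, Set.mem_ofPred_eq, Finset.mem_coe, exists_prop]
      constructor
      · rintro ⟨hc, hcρ⟩
        obtain ⟨v, hv, h⟩ := hrep c
        refine ⟨rep c, hXQ c hc, v, ⟨hv, fun i => ?_⟩, h⟩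
        rw [← Pi.vadd_apply, h]
        exact hcρ i
      · rintro ⟨q, hq, v, ⟨hv, h⟩, rfl⟩
        exact ⟨hinv v hv q (hQX q hq), h⟩
    have hfin : ∀ q ∈ Q, {v : E | v ∈ L ∧ ∀ i, ((v +ᵥ q i) ∩ Metric.ball 0 ρ).Nonempty}.Finite := by
      intro q hq
      obtain ⟨i⟩ := ‹Nonempty ι›
      refine (finite_lattice_inter L (s := Metric.ball 0 ρ - q i)
        (Metric.isBounded_ball.sub (hb q (hQX q hq) i))).subset ?_
      rintro v ⟨hv, h⟩
      obtain ⟨_, ⟨x, hx, rfl⟩, hxρ⟩ := h i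
      exact ⟨hv, _, hxρ, x, hx, by simp⟩
    rw [hunion, Q.finite_toSet.ncard_biUnion (fun q hq => (hfin q hq).image _),
      finsum_mem_coe_finset]
    · refine Finset.sum_congr rfl fun q hq => ?_
      refine Set.ncard_image_of_injective _ fun v w hvw => ?_
      obtain ⟨i⟩ := ‹Nonempty ι›
      exact eq_of_vadd_eq_vadd_of_isBounded (hb q (hQX q hq) i) (hne q (hQX q hq) i)
        (congrFun hvw i)
    · intro q hq q' hq' hqq'
      refine Set.disjoint_left.2 ?_
      rintro _ ⟨v, ⟨hv, -⟩, rfl⟩ ⟨w, ⟨hw, -⟩, hvw⟩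
      refine hqq' ?_
      have hvw' : w +ᵥ q' = v +ᵥ q := hvw
      rw [← hQrep q hq, ← hQrep q' hq', ← hrep_eq q v hv, ← hrep_eq q' w hw, hvw']
  simp only [hcount, Nat.cast_sum, Finset.sum_div]
  rw [← nsmul_eq_mul, ← Finset.sum_const]
  exact tendsto_finsetSum _ fun q hq =>
    tendsto_translate_count L q (hne q (hQX q hq)) (hb q (hQX q hq))

end LatticeCount

end PolytopeTiling

/-! ### Flag counts of periodic normal tilings. -/

namespace PolytopeTiling

open scoped Pointwise

section FlagCount

variable {E : Type*} [NormedAddCommGroup E] [NormedSpace ℝ E] {𝒯 : Set (Set E)}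

theorem flagCount_singleton (𝒯 : Set (Set E)) (i : ℕ) (ρ : ℝ) :
    flagCount 𝒯 {i} ρ = faceCount 𝒯 i ρ := by
  have hinj : Function.Injective fun (c : ({i} : Finset ℕ) → Set E) =>
      c ⟨i, Finset.mem_singleton_self i⟩ := by
    intro c c' h
    funext ⟨j, hj⟩
    obtain rfl := Finset.mem_singleton.1 hj
    exact h
  rw [flagCount, faceCount, ← Set.ncard_image_of_injective _ hinj]
  congr 1
  ext F
  constructor
  · rintro ⟨c, ⟨hc, -⟩, rfl⟩
    exact hc ⟨i, Finset.mem_singleton_self i⟩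
  · intro hF
    refine ⟨fun _ => F, ⟨fun j => ?_, fun _ _ _ => le_rfl⟩, rfl⟩
    rw [Finset.mem_singleton.1 j.2]
    exact hF

/-- The chains of nonempty faces of a tiling, with one face of dimension `i` for each `i ∈ S`. -/
def faceChains (𝒯 : Set (Set E)) (S : Finset ℕ) : Set (S → Set E) :=
  {c | (∀ i : S, (∃ T ∈ 𝒯, IsExposed ℝ T (c i)) ∧
    Module.finrank ℝ (vectorSpan ℝ (c i)) = i ∧ (c i).Nonempty) ∧ Monotone c}

theorem flagCount_eq (𝒯 : Set (Set E)) (S : Finset ℕ) (ρ : ℝ) :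
    flagCount 𝒯 S ρ =
      {c | c ∈ faceChains 𝒯 S ∧ ∀ i, (c i ∩ Metric.ball 0 ρ).Nonempty}.ncard := by
  rw [flagCount]
  congr 1
  ext c
  constructor
  · rintro ⟨h, hmono⟩
    exact ⟨⟨fun i => ⟨(h i).1, (h i).2.1, (h i).2.2.mono Set.inter_subset_left⟩, hmono⟩,
      fun i => (h i).2.2⟩
  · rintro ⟨⟨h, hmono⟩, hne⟩
    exact ⟨fun i => ⟨(h i).1, (h i).2.1, hne i⟩, hmono⟩

theorem vadd_mem_faceChains {v : E} (hv : ∀ T ∈ 𝒯, v +ᵥ T ∈ 𝒯) {S : Finset ℕ} {c : S → Set E}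
    (hc : c ∈ faceChains 𝒯 S) : v +ᵥ c ∈ faceChains 𝒯 S := by
  refine ⟨fun i => ?_, fun i j hij => Set.vadd_set_mono (hc.2 hij)⟩
  obtain ⟨⟨T, hT, hTc⟩, hdim, hne⟩ := hc.1 i
  refine ⟨⟨_, hv T hT, hTc.vadd v⟩, ?_, hne.vadd_set⟩
  rw [Pi.vadd_apply, vectorSpan_vadd, hdim]

theorem IsFaceToFaceTiling.faceChains_nonempty [FiniteDimensional ℝ E]
    (h𝒯 : IsFaceToFaceTiling 𝒯) {S : Finset ℕ}
    (hS : S ⊆ Finset.range (Module.finrank ℝ E + 1)) : (faceChains 𝒯 S).Nonempty := by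
  obtain ⟨T, hT, hx⟩ := h𝒯.sUnion_eq.symm ▸ Set.mem_univ (0 : E)
  obtain ⟨c, hc, hmono⟩ := (h𝒯.isConvexPolytope T hT).exists_flag ⟨0, hx⟩
    (n := Module.finrank ℝ E)
    (by rw [vectorSpan_eq_top_of_interior_nonempty (h𝒯.interior_nonempty T hT), finrank_top])
  have hle : ∀ i ∈ S, i ≤ Module.finrank ℝ E := fun i hi =>
    Nat.lt_succ_iff.1 (Finset.mem_range.1 (hS hi))
  refine ⟨fun i => c i, fun i => ?_, fun i j hij => hmono i j hij (hle j j.2)⟩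
  obtain ⟨h1, h2, h3⟩ := hc i (hle i i.2)
  exact ⟨⟨T, hT, h1⟩, h3, h2⟩

/-- Subtracting the integer part with respect to a lattice basis leads into a bounded fundamental
parallelepiped. -/
theorem exists_lattice_translate_norm_le [FiniteDimensional ℝ E] (L : Submodule ℤ E)
    [DiscreteTopology L] [IsZLattice ℝ L] : ∃ M : ℝ, ∀ x : E, ∃ v ∈ L, ‖v + x‖ ≤ M := by
  let b := (Module.Free.chooseBasis ℤ L).ofZLatticeBasis ℝ L
  refine ⟨∑ i, ‖b i‖, fun x => ⟨-(ZSpan.floor b x : E), ?_, ?_⟩⟩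
  · exact L.neg_mem
      (((Module.Free.chooseBasis ℤ L).ofZLatticeBasis_span ℝ).le (ZSpan.floor b x).2)
  · rw [neg_add_eq_sub]
    exact ZSpan.norm_fract_le b x

end FlagCount

section Asymptotics

variable {E : Type*} [NormedAddCommGroup E] [InnerProductSpace ℝ E] [FiniteDimensional ℝ E]
  {𝒯 : Set (Set E)}

theorem IsNormalTiling.tendsto_flagCount_div_pow [Nontrivial E] (h𝒯 : IsNormalTiling 𝒯)
    (hL : IsLatticePeriodic 𝒯) {S : Finset ℕ} (hS : S.Nonempty) :
    ∃ c : ℝ, Tendsto (fun ρ : ℝ => (flagCount 𝒯 S ρ : ℝ) / ρ ^ Module.finrank ℝ E) atTop (𝓝 c) ∧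
      (S ⊆ Finset.range (Module.finrank ℝ E + 1) → 0 < c) := by
  borelize E
  obtain ⟨L, hLd, hLz, hinv⟩ := hL
  obtain ⟨M, hM⟩ := exists_lattice_translate_norm_le L
  obtain ⟨D, hD0, hD⟩ := h𝒯.exists_dist_le
  have hface : ∀ c ∈ faceChains 𝒯 S, ∀ i, ∀ x ∈ c i, ∀ y ∈ c i, dist x y ≤ D := by
    intro c hc i x hx y hy
    obtain ⟨T, hT, hTc⟩ := (hc.1 i).1
    exact hD T hT x (hTc.subset hx) y (hTc.subset hy)
  have hinv' : ∀ v ∈ L, ∀ c ∈ faceChains 𝒯 S, v +ᵥ c ∈ faceChains 𝒯 S :=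
    fun v hv c hc => vadd_mem_faceChains (fun T hT => hinv v hv T hT) hc
  have : Nonempty S := hS.to_subtype
  -- A translate brings a point of one face within `M` of the origin. Larger faces of the chain
  -- contain that point, and smaller ones lie within `D` of it; the `1` makes the bound strict.
  set B := {c | c ∈ faceChains 𝒯 S ∧ ∀ i, (c i ∩ Metric.ball 0 (M + D + 1)).Nonempty} with hBdef
  have hB : B.Finite := by
    refine (Set.Finite.pi' fun i : S => h𝒯.finite_facesMeeting i (M + D + 1)).subset ?_
    rintro c ⟨hc, hne⟩ i
    exact ⟨(hc.1 i).1, (hc.1 i).2.1, hne i⟩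
  have hXB : ∀ c ∈ faceChains 𝒯 S, ∃ v ∈ L, v +ᵥ c ∈ B := by
    intro c hc
    obtain ⟨i₀⟩ := this
    obtain ⟨x, hx⟩ := (hc.1 i₀).2.2
    obtain ⟨v, hv, hvx⟩ := hM x
    have hvc := hinv' v hv c hc
    refine ⟨v, hv, hvc, fun i => ?_⟩
    have hx' : v + x ∈ (v +ᵥ c) i₀ := Set.vadd_mem_vadd_set hx
    rcases le_total i₀ i with h | h
    · refine ⟨v + x, hvc.2 h hx', ?_⟩
      rw [mem_ball_zero_iff]
      linarith
    · obtain ⟨y, hy⟩ := (hvc.1 i).2.2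
      refine ⟨y, hy, ?_⟩
      have h1 := hface _ hvc i₀ y (hvc.2 h hy) (v + x) hx'
      have h2 := dist_triangle y (v + x) 0
      rw [dist_zero_right, dist_zero_right] at h2
      rw [mem_ball_zero_iff]
      linarith
  obtain ⟨m, hm, hm0⟩ := tendsto_orbit_count L (faceChains 𝒯 S) B hinv'
    (fun c hc i => (hc.1 i).2.2)
    (fun c hc i => Metric.isBounded_iff.2 ⟨D, fun x hx y hy => hface c hc i x hx y hy⟩) hB hXB
    fun c hc => hc.1
  simp only [← flagCount_eq] at hm
  refine ⟨_, hm, fun hSn => mul_pos ?_ (latticeDensity_pos L)⟩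
  exact_mod_cast hm0 (h𝒯.toIsFaceToFaceTiling.faceChains_nonempty hSn)

/-- The flag numbers of a periodic normal tiling, relative to the number of all faces. -/
theorem IsNormalTiling.exists_flag_limits [Nontrivial E] (h𝒯 : IsNormalTiling 𝒯)
    (hL : IsLatticePeriodic 𝒯) :
    ∃ ψ : Finset ℕ → ℝ, (∀ S : Finset ℕ, S.Nonempty →
      Tendsto (fun ρ : ℝ => (flagCount 𝒯 S ρ : ℝ) /
        ∑ j ∈ Finset.range (Module.finrank ℝ E + 1), (faceCount 𝒯 j ρ : ℝ)) atTop (𝓝 (ψ S))) ∧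
      ∀ S ⊆ Finset.range (Module.finrank ℝ E + 1), S.Nonempty → 0 < ψ S := by
  choose! c hc hpos using fun (S : Finset ℕ) (hS : S.Nonempty) =>
    h𝒯.tendsto_flagCount_div_pow hL hS
  set n := Module.finrank ℝ E
  have hsum : Tendsto (fun ρ : ℝ => (∑ j ∈ Finset.range (n + 1), (faceCount 𝒯 j ρ : ℝ)) / ρ ^ n)
      atTop (𝓝 (∑ j ∈ Finset.range (n + 1), c {j})) := by
    simp only [Finset.sum_div, ← flagCount_singleton]
    exact tendsto_finsetSum _ fun j _ => hc {j} (Finset.singleton_nonempty j)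
  have hC : 0 < ∑ j ∈ Finset.range (n + 1), c {j} :=
    Finset.sum_pos (fun j hj => hpos {j} (Finset.singleton_nonempty j)
      (Finset.singleton_subset_iff.2 hj)) (Finset.nonempty_range_iff.2 n.succ_ne_zero)
  refine ⟨fun S => c S / ∑ j ∈ Finset.range (n + 1), c {j}, fun S hS => ?_,
    fun S hSn hS => div_pos (hpos S hS hSn) hC⟩
  refine ((hc S hS).div hsum hC.ne').congr' ?_
  filter_upwards [eventually_gt_atTop 0] with ρ hρ
  exact div_div_div_cancel_right₀ (pow_ne_zero n hρ.ne') _ _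

theorem tendsto_div_of_tendsto_div {f g h : ℝ → ℝ} {a b : ℝ}
    (hf : Tendsto (fun ρ => f ρ / h ρ) atTop (𝓝 a))
    (hg : Tendsto (fun ρ => g ρ / h ρ) atTop (𝓝 b)) (hh : Tendsto h atTop atTop) (hb : b ≠ 0) :
    Tendsto (fun ρ => f ρ / g ρ) atTop (𝓝 (a / b)) := by
  refine (hf.div hg hb).congr' ?_
  filter_upwards [hh.eventually_gt_atTop 0] with ρ hρ
  exact div_div_div_cancel_right₀ hρ.ne' _ _

end Asymptotics

end PolytopeTiling



/-! ### Assembly of the theorem. -/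

open PolytopeTiling in
theorem mainTheorem3 (n : ℕ) (hn : 1 ≤ n) (𝒯 : Set (Set (EuclideanSpace ℝ (Fin n))))
    (h𝒯 : IsNormalTiling 𝒯) :
    (∀ ρ : ℝ, 0 < ρ →
      (∀ i, (facesMeeting 𝒯 i ρ).Finite) ∧
      ∑ i ∈ Finset.range (n + 1), (-1 : ℤ) ^ i * (faceCount 𝒯 i ρ : ℤ) = (-1) ^ n) ∧
    (∀ i ≤ n, ∀ φ : ℝ,
      Tendsto (fun ρ : ℝ => (faceCount 𝒯 i ρ : ℝ) /
        ∑ j ∈ Finset.range (n + 1), (faceCount 𝒯 j ρ : ℝ)) atTop (𝓝 φ) →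
      0 ≤ φ ∧ φ ≤ 1 / 2) ∧
    (IsLatticePeriodic 𝒯 →
      ∃ (φ : ℕ → ℝ) (ψ : Finset ℕ → ℝ),
        -- the limits `φ i` exist and are positive
        (∀ i, Tendsto (fun ρ : ℝ => (faceCount 𝒯 i ρ : ℝ) /
          ∑ j ∈ Finset.range (n + 1), (faceCount 𝒯 j ρ : ℝ)) atTop (𝓝 (φ i))) ∧
        (∀ i ≤ n, 0 < φ i) ∧
        -- the Euler formula for tilings
        ∑ i ∈ Finset.range (n + 1), (-1 : ℝ) ^ i * φ i = 0 ∧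
        -- the fatness is well defined, positive and finite
        0 < φ 0 + φ 3 ∧
        0 < (φ 1 + φ 2) / (φ 0 + φ 3) ∧
        Tendsto (fun ρ : ℝ => ((faceCount 𝒯 1 ρ : ℝ) + faceCount 𝒯 2 ρ) /
          ((faceCount 𝒯 0 ρ : ℝ) + faceCount 𝒯 3 ρ)) atTop
          (𝓝 ((φ 1 + φ 2) / (φ 0 + φ 3))) ∧
        -- the same for flag numbers and their quotients
        (∀ i, ψ {i} = φ i) ∧
        (∀ S ⊆ Finset.range (n + 1), S.Nonempty → 0 < ψ S ∧
          Tendsto (fun ρ : ℝ => (flagCount 𝒯 S ρ : ℝ) /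
            ∑ j ∈ Finset.range (n + 1), (faceCount 𝒯 j ρ : ℝ)) atTop (𝓝 (ψ S))) ∧
        (∀ a b : Finset ℕ → ℝ, (∀ S, 0 ≤ a S) → (∀ S, 0 ≤ b S) →
          (∃ S ⊆ Finset.range (n + 1), S.Nonempty ∧ 0 < a S) →
          (∃ S ⊆ Finset.range (n + 1), S.Nonempty ∧ 0 < b S) →
          0 < (∑ S ∈ (Finset.range (n + 1)).powerset.erase ∅, a S * ψ S) /
            (∑ S ∈ (Finset.range (n + 1)).powerset.erase ∅, b S * ψ S) ∧
          Tendsto (fun ρ : ℝ =>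
            (∑ S ∈ (Finset.range (n + 1)).powerset.erase ∅, a S * (flagCount 𝒯 S ρ : ℝ)) /
            (∑ S ∈ (Finset.range (n + 1)).powerset.erase ∅, b S * (flagCount 𝒯 S ρ : ℝ)))
            atTop
            (𝓝 ((∑ S ∈ (Finset.range (n + 1)).powerset.erase ∅, a S * ψ S) /
              (∑ S ∈ (Finset.range (n + 1)).powerset.erase ∅, b S * ψ S))))) := by
  -- In the form `k + 1` the dimension makes the space visibly nontrivial to instance search.
  obtain ⟨k, rfl⟩ : ∃ k, n = k + 1 := ⟨n - 1, by omega⟩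
  have hfin : Module.finrank ℝ (EuclideanSpace ℝ (Fin (k + 1))) = k + 1 := by simp
  have hN := h𝒯.tendsto_sum_faceCount
  rw [hfin] at hN
  have heuler := fun (ρ : ℝ) (hρ : 0 < ρ) => h𝒯.euler_relation hρ
  rw [hfin] at heuler
  refine ⟨fun ρ hρ => ⟨fun i => h𝒯.finite_facesMeeting i ρ, heuler ρ hρ⟩, fun i hi φ h => ?_,
    fun hL => ?_⟩
  · exact h𝒯.limit_le_half (i := i) (by rwa [hfin]) (by rwa [hfin])
  obtain ⟨ψ, hψ, hpos⟩ := h𝒯.exists_flag_limits hL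
  rw [hfin] at hψ hpos
  have hφ : ∀ i, Tendsto (fun ρ : ℝ => (faceCount 𝒯 i ρ : ℝ) /
      ∑ j ∈ Finset.range (k + 1 + 1), (faceCount 𝒯 j ρ : ℝ)) atTop (𝓝 (ψ {i})) := by
    intro i
    simpa only [flagCount_singleton] using hψ {i} (Finset.singleton_nonempty i)
  have hφ0 : ∀ i, 0 ≤ ψ {i} := fun i => ge_of_tendsto' (hφ i) fun ρ => by positivity
  have hφpos : ∀ i ≤ k + 1, 0 < ψ {i} := fun i hi =>
    hpos {i} (by simpa using Nat.lt_succ_of_le hi) (Finset.singleton_nonempty i)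
  -- Dimension `3` may exceed `n`, so only nonnegativity is available for the second term; the same
  -- holds for `ψ {2}` below.
  have h03 : 0 < ψ {0} + ψ {3} := add_pos_of_pos_of_nonneg (hφpos 0 (by omega)) (hφ0 3)
  have h12 : 0 < ψ {1} + ψ {2} := add_pos_of_pos_of_nonneg (hφpos 1 (by omega)) (hφ0 2)
  have hlin : ∀ a : Finset ℕ → ℝ, Tendsto (fun ρ : ℝ =>
      (∑ S ∈ (Finset.range (k + 1 + 1)).powerset.erase ∅, a S * (flagCount 𝒯 S ρ : ℝ)) /
        ∑ j ∈ Finset.range (k + 1 + 1), (faceCount 𝒯 j ρ : ℝ)) atTop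
      (𝓝 (∑ S ∈ (Finset.range (k + 1 + 1)).powerset.erase ∅, a S * ψ S)) := by
    intro a
    simp only [Finset.sum_div, mul_div_assoc]
    refine tendsto_finsetSum _ fun S hS => (hψ S ?_).const_mul _
    exact Finset.nonempty_iff_ne_empty.2 (Finset.mem_erase.1 hS).1
  have hlinpos : ∀ a : Finset ℕ → ℝ, (∀ S, 0 ≤ a S) →
      (∃ S ⊆ Finset.range (k + 1 + 1), S.Nonempty ∧ 0 < a S) →
      0 < ∑ S ∈ (Finset.range (k + 1 + 1)).powerset.erase ∅, a S * ψ S := by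
    rintro a ha ⟨S, hSn, hS, haS⟩
    refine Finset.sum_pos' (fun S' hS' => mul_nonneg (ha S') ?_)
      ⟨S, ?_, mul_pos haS (hpos S hSn hS)⟩
    · rw [Finset.mem_erase, Finset.mem_powerset] at hS'
      exact (hpos S' hS'.2 (Finset.nonempty_iff_ne_empty.2 hS'.1)).le
    · rw [Finset.mem_erase, Finset.mem_powerset]
      exact ⟨hS.ne_empty, hSn⟩
  refine ⟨fun i => ψ {i}, ψ, hφ, hφpos, ?_, h03, div_pos h12 h03, ?_, fun _ => rfl,
    fun S hSn hS => ⟨hpos S hSn hS, hψ S hS⟩, fun a b ha hb ha' hb' =>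
      ⟨div_pos (hlinpos a ha ha') (hlinpos b hb hb'),
        tendsto_div_of_tendsto_div (hlin a) (hlin b) hN (hlinpos b hb hb').ne'⟩⟩
  · have h1 : Tendsto (fun ρ : ℝ => ∑ i ∈ Finset.range (k + 1 + 1), (-1 : ℝ) ^ i *
        ((faceCount 𝒯 i ρ : ℝ) / ∑ j ∈ Finset.range (k + 1 + 1), (faceCount 𝒯 j ρ : ℝ))) atTop
        (𝓝 (∑ i ∈ Finset.range (k + 1 + 1), (-1 : ℝ) ^ i * ψ {i})) :=
      tendsto_finsetSum _ fun i _ => (hφ i).const_mul _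
    -- By Euler's relation the alternating sum of quotients is `(-1) ^ n` divided by the total,
    -- which tends to `0`.
    refine tendsto_nhds_unique h1 ((hN.const_div_atTop ((-1 : ℝ) ^ (k + 1))).congr' ?_)
    filter_upwards [eventually_gt_atTop 0] with ρ hρ
    have h2 : ∑ i ∈ Finset.range (k + 1 + 1), (-1 : ℝ) ^ i * (faceCount 𝒯 i ρ : ℝ) =
        (-1) ^ (k + 1) := by exact_mod_cast heuler ρ hρ
    simp only [← mul_div_assoc, ← Finset.sum_div, h2]
  · refine tendsto_div_of_tendsto_div ?_ ?_ hN h03.ne'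
    · simpa only [add_div] using (hφ 1).add (hφ 2)
    · simpa only [add_div] using (hφ 0).add (hφ 3)
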